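/- **Setting.** Let $C\subset\{v\in\mathbb C:\operatorname{Re}v>0\}$ be a contour (any Borel set is allowed) carrying a $\sigma$-finite complex measure $\mu(dv)=\omega(v)\,|\mu|(dv)$, where $|\mu|$ is a $\sigma$-finite positive measure and $|\omega|=1$ (for instance $dv$ on a vertical line). For a real parameter $z$ let $\nu_z$ be a $\sigma$-finite positive Borel measure on $\mathbb R$, and let $\phi_{\rm odd},\phi_{\rm even}:\mathbb C\to\mathbb C$ be measurable. For $n\ge 0$ put $$Z(n,z)=\int_{\mathbb R^n}\prod_{p=1}^{n}\nu_z(dr_p)\int_{C^{2n}}\prod_{i=1}^{2n}\mu(dX_i)\ \prod_{p=1}^{n}\Big[\phi_{\rm odd}(X_{2p-1})\,\phi_{\rm even}(X_{2p})\,e^{-r_p(X_{2p-1}+X_{2p})}\Big]\ \mathrm{Pf}\Big[\frac{X_i-X_j}{X_i+X_j}\Big]_{i,j=1}^{2n},$$ $$Q(z)=1+\sum_{n\ge1}\frac{(-1)^n}{n!}Z(n,z),\qquad f_a(r)=\int_C\mu(dv)\,\phi_a(v)\,e^{-rv}\quad(a\in\{{\rm odd},{\rm even}\}),$$ $$\bar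 K(x,y)=2\int_{\mathbb R}\nu_z(dr)\,\big[f_{\rm even}'(r+x)f_{\rm odd}(r+y)-f_{\rm odd}'(r+x)f_{\rm even}(r+y)\big]\qquad(x,y\ge 0).$$ Here $\mathrm{Pf}\,A=\frac1{2^n n!}\sum_{\sigma\in S_{2n}}\mathrm{sgn}(\sigma)\prod_{p=1}^nA_{\sigma(2p-1)\sigma(2p)}$, and the Fredholm determinant of a kernel $L$ on $L^2(\mathbb R^+)$ with Lebesgue measure is $$\mathrm{Det}[I-L]=\sum_{n\ge0}\frac{(-1)^n}{n!}\int_{(\mathbb R^+)^n}\det[L(x_i,x_j)]_{i,j=1}^n\,dx_1\cdots dx_n .$$ **Assumptions on convergence.** For $\nu_z$-almost every $r$, and $a,b\in\{{\rm odd},{\rm even}\}$: 1. $\int_C(1+|v|)\,|\phi_a(v)|\,e^{-r\operatorname{Re}v}\,|\mu|(dv)<\infty$; 2. $\int_C\int_C|\phi_a(v)\phi_b(w)|\,\big|\tfrac{v-w}{v+w}\big|\,e^{-r\operatorname{Re}(v+w)}\,|\mu|(dv)\,|\mu|(dw)<\infty$; and 3. the kernels $f_a(r+x)$ and $f_a'(r+x)$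 are Hilbert–Schmidt, i.e. as functions of $(r,x)$ they belong to $L^2(\mathbb R\times\mathbb R^+,\nu_z\otimes dx)$. **Proposition.** For every $n$ the inner integrand of $Z(n,z)$ is absolutely integrable in $X$ for $\nu_z^{\otimes n}$-a.e. $(r_1,\dots,r_n)$, and the resulting function of $(r_1,\dots,r_n)$ is $\nu_z^{\otimes n}$-integrable. For $\nu_z$-a.e. $r$ the functions $f_{\rm odd},f_{\rm even}$ are differentiable at $r+x$ for all $x>0$. For a.e. $x>0$ and all $y\ge0$ the integral defining $\bar K(x,y)$ converges absolutely. For every $\tau\in\mathbb C$ the series $$q(\tau)=\sum_{n\ge0}\frac{(-\tau)^n}{n!}Z(n,z)$$ and all integrals and the series defining $\mathrm{Det}[I-\tau\bar K]_{L^2(\mathbb R^+)}$ converge absolutely; $q$ is entire, $q(0)=1$, $q(1)=Q(z)$, and $$q(\tau)^2=\mathrm{Det}\big[I-\tau\bar K\big]_{L^2(\mathbb R^+)}\qquad\text{for all }\tau\in\mathbb C.$$ In particular $Q(z)$ is the square root of the scalar Fredholm determinant, $$Q(z)^2=\mathrm{Det}\big[I-\bar K\big]_{L^2(\mathbb R^+)},\qquad\text{i.e.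 } Q(z)=\sqrt{\mathrm{Det}[I-\bar K]_{L^2(\mathbb R^+)}},$$ where the branch of the square root is the one obtained by analytic continuation of $\tau\mapsto\sqrt{\mathrm{Det}[I-\tau\bar K]}$ from the value $1$ at $\tau=0$ to $\tau=1$. It is the principal square root whenever $\operatorname{Re}Q(z)>0$ or $Q(z)=0$. -/

import Mathlib

open MeasureTheory Set

noncomputable section

namespace PfaffianDet

/-- A sigma-finite complex Borel measure `μ` carried by a contour `C` in the complex plane, given by
its polar decomposition `μ(dv) = phase v * |μ|(dv)`, where `total = |μ|` is the variation measure and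
`|phase| = 1`. For the line integral `∫_C g(v) dv` along a rectifiable curve, `total` is arc length
and `phase` is the unit tangent vector; for instance `phase = i` on an upward vertical line.
The total mass of `|μ|` may be infinite. -/
structure ContourMeasure where
  /-- the contour -/
  C : Set ℂ
  /-- the variation measure `|μ|` -/
  total : Measure ℂ
  /-- the phase `dμ / d|μ|` -/
  phase : ℂ → ℂ
  measurableSet_C : MeasurableSet C
  sigmaFinite_total : SigmaFinite total
  total_compl : total Cᶜ = 0
  measurable_phase : Measurable phase
  norm_phase : ∀ v, ‖phase v‖ = 1

instance (μ : ContourMeasure) : SigmaFinite μ.total := μ.sigmaFinite_total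

/-- The Pfaffian of a `2n × 2n` skew-symmetric matrix,
`(2ⁿ n!)⁻¹ ∑_σ sgn(σ) ∏_p A_{σ(2p-1), σ(2p)}`. The indices `1, …, 2n` are organised in `n` blocks of
two consecutive indices: `(p, 0)` is the index `2p-1` and `(p, 1)` is the index `2p`. -/
def pfaffian {n : ℕ} (A : Matrix (Fin n × Fin 2) (Fin n × Fin 2) ℂ) : ℂ :=
  ((2 : ℂ) ^ n * (n.factorial : ℂ))⁻¹ *
    ∑ σ : Equiv.Perm (Fin n × Fin 2),
      ((Equiv.Perm.sign σ : ℤ) : ℂ) * ∏ p : Fin n, A (σ (p, 0)) (σ (p, 1))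

/-- The Schur matrix `(X_i - X_j) / (X_i + X_j)`. -/
def schurMatrix {n : ℕ} (X : Fin n × Fin 2 → ℂ) : Matrix (Fin n × Fin 2) (Fin n × Fin 2) ℂ :=
  Matrix.of fun i j => (X i - X j) / (X i + X j)

/-- The integrand of `Z(n, z)` with respect to `|μ|^{⊗ 2n}(dX)`; the last product turns
`|μ|(dX_i)` into `μ(dX_i)`. -/
def momentIntegrand (μ : ContourMeasure) (φodd φeven : ℂ → ℂ) {n : ℕ}
    (r : Fin n → ℝ) (X : Fin n × Fin 2 → ℂ) : ℂ :=
  (∏ p : Fin n, φodd (X (p, 0)) * φeven (X (p, 1)) *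
      Complex.exp (-(r p : ℂ) * (X (p, 0) + X (p, 1)))) *
    pfaffian (schurMatrix X) * ∏ i, μ.phase (X i)

/-- The inner integral of `Z(n, z)`, over `X_1, …, X_{2n}`, at fixed `r_1, …, r_n`. -/
def momentInner (μ : ContourMeasure) (φodd φeven : ℂ → ℂ) {n : ℕ} (r : Fin n → ℝ) : ℂ :=
  ∫ X : Fin n × Fin 2 → ℂ, momentIntegrand μ φodd φeven r X ∂(Measure.pi fun _ => μ.total)

/-- `Z(n, z)`, for `ν = ν_z`. -/
def Z (μ : ContourMeasure) (ν : Measure ℝ) (φodd φeven : ℂ → ℂ) (n : ℕ) : ℂ :=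
  ∫ r : Fin n → ℝ, momentInner μ φodd φeven r ∂(Measure.pi fun _ => ν)

/-- `Q(z) = 1 + ∑_{n ≥ 1} (-1)ⁿ / n! Z(n, z)`. -/
def Q (μ : ContourMeasure) (ν : ℝ → Measure ℝ) (φodd φeven : ℂ → ℂ) (z : ℝ) : ℂ :=
  1 + ∑' n : ℕ, (-1) ^ (n + 1) / ((n + 1).factorial : ℂ) * Z μ (ν z) φodd φeven (n + 1)

/-- The transform `f(r) = ∫_C μ(dv) φ(v) e^{-rv}`. -/
def transform (μ : ContourMeasure) (φ : ℂ → ℂ) (r : ℝ) : ℂ :=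
  ∫ v, φ v * Complex.exp (-(r : ℂ) * v) * μ.phase v ∂μ.total

/-- The integrand of the scalar kernel,
`f_even'(r + x) f_odd(r + y) - f_odd'(r + x) f_even(r + y)`. -/
def kernelIntegrand (fodd feven : ℝ → ℂ) (x y r : ℝ) : ℂ :=
  deriv feven (r + x) * fodd (r + y) - deriv fodd (r + x) * feven (r + y)

/-- The scalar kernel `K̄(x, y)`. -/
def scalarKernel (ν : Measure ℝ) (fodd feven : ℝ → ℂ) (x y : ℝ) : ℂ :=
  2 * ∫ r, kernelIntegrand fodd feven x y r ∂ν

/-- The uniform (Lebesgue) measure on the half-line `ℝ⁺`. -/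
def halfLine : Measure ℝ := volume.restrict (Ioi 0)

instance : SigmaFinite halfLine := by unfold halfLine; infer_instance

/-- The minor `det [K(x_i, x_j)]`. -/
def kernelMinor (K : ℝ → ℝ → ℂ) {n : ℕ} (x : Fin n → ℝ) : ℂ :=
  (Matrix.of fun i j : Fin n => K (x i) (x j)).det

/-- The `n`-th term `(-1)ⁿ / n! ∫ det [K(x_i, x_j)] dx` of the Fredholm expansion on `L²(ℝ⁺)`. -/
def fredholmTerm (K : ℝ → ℝ → ℂ) (n : ℕ) : ℂ :=
  (-1) ^ n / (n.factorial : ℂ) * ∫ x : Fin n → ℝ, kernelMinor K x ∂(Measure.pi fun _ => halfLine)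

/-- The Fredholm expansion of `Det [I - K]` on `L²(ℝ⁺)` converges absolutely. -/
def FredholmConverges (K : ℝ → ℝ → ℂ) : Prop :=
  (∀ n : ℕ, Integrable (fun x : Fin n → ℝ => kernelMinor K x) (Measure.pi fun _ => halfLine)) ∧
    Summable (fredholmTerm K)

/-- The Fredholm determinant `Det [I - K]` on `L²(ℝ⁺)`. -/
def fredholmDet (K : ℝ → ℝ → ℂ) : ℂ := ∑' n : ℕ, fredholmTerm K n

/-- The kernel `f(r + x)`, as a function of `(r, x)`, belongs to `L²(ν ⊗ dx)` on `ℝ × ℝ⁺`: it is the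
kernel of a Hilbert-Schmidt operator between `L²(ℝ⁺)` and `L²(ℝ, ν)`. -/
def ShiftHilbertSchmidt (ν : Measure ℝ) (f : ℝ → ℂ) : Prop :=
  MemLp (fun p : ℝ × ℝ => f (p.1 + p.2)) 2 (ν.prod halfLine)

end PfaffianDet

end

open PfaffianDet

/-! Write `f a` for the transform of `φ a`, with 0 for odd and 1 for even. Integrating the Pfaffian
term by term, each `X`-integral at fixed `r` becomes the Pfaffian of the skew matrix `pairMatrix`,
whose entries are double integrals against (v - w)/(v + w) (`momentInner_eq_blockPf`). Inserting
e^{-x(v+w)} and differentiating in x removes the denominator. Hence (`pairKernel_eq_integral`) an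
entry with transforms f, g equals ∫ (f g' - f' g) over the half-line, and adding the boundary term
f(r) g(r') turns it into -2 ∫ f' g. So the skew matrix K becomes a matrix of composed kernels after
adding a symmetric rank-one matrix u uᵀ.

The coefficients of q² are binomial convolutions of the `Z n`, that is, integrals of ∑_V Pf(K_V)
Pf(K_{Vᶜ}) over sets V of blocks. In `sum_blockPf_mul_blockPf_compl` this sum is extracted from Pf(K
+ ∑ ε_p J_p)² by averaging over signs ε, where J_p is the symplectic block at p. Since Pf² = det,
and a skew determinant of even size does not see u uᵀ, the same average is also a sum of n × n
minors of Jᵀ(K + u uᵀ), with one row and the matching column chosen from each block. Andréief's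
identity (`integral_det_comp_eq`) trades the integral over `r` for one over the half-line, and
multilinearity in the rows resums the choices into the minor of the scalar kernel. The Cauchy
product then gives q² as the Fredholm series.

Convergence comes from Hadamard's inequality: the entries of K are inner products in L² ⊕ L², so |Pf
K| is at most a product of energies. These are integrable by the Hilbert-Schmidt assumption, so `Z
n` grows at most geometrically (`Admissible.norm_Z_le`) and the factorials make q entire. -/

namespace PfaffianDet

open Equiv

/-! ### Pfaffians indexed by blocks: congruence and symmetries. -/

section Pfaffian

variable {P P' : Type} [Fintype P] [DecidableEq P] [Fintype P'] [DecidableEq P']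

/-- The signed product of entries attached to a permutation in the expansion of the Pfaffian. -/
noncomputable def pfTerm (A : Matrix (P × Fin 2) (P × Fin 2) ℂ) (σ : Perm (P × Fin 2)) : ℂ :=
  ((Perm.sign σ : ℤ) : ℂ) * ∏ p : P, A (σ (p, 0)) (σ (p, 1))

/-- The Pfaffian of a matrix whose indices are organised in blocks of two,
labelled by a finite type. -/
noncomputable def blockPf (A : Matrix (P × Fin 2) (P × Fin 2) ℂ) : ℂ :=
  ((2 : ℂ) ^ Fintype.card P * ((Fintype.card P).factorial : ℂ))⁻¹ * ∑ σ, pfTerm A σ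

theorem blockPf_reindex (e : P' ≃ P) (A : Matrix (P × Fin 2) (P × Fin 2) ℂ) :
    blockPf (A.submatrix (Prod.map e id) (Prod.map e id)) = blockPf A := by
  unfold blockPf
  rw [Fintype.card_congr e]
  congr 1
  let E : P' × Fin 2 ≃ P × Fin 2 := e.prodCongr (Equiv.refl _)
  refine Fintype.sum_equiv E.permCongr _ _ fun σ => ?_
  unfold pfTerm
  rw [Perm.sign_permCongr]
  congr 1
  refine Fintype.prod_equiv e _ _ fun p => ?_
  simp only [Matrix.submatrix_apply, Equiv.permCongr_apply]
  have h0 : ∀ a : Fin 2, E.symm (e p, a) = (p, a) := fun a => by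
    rw [Equiv.symm_apply_eq]; rfl
  rw [h0, h0]; rfl

/-- Expanding the matrix products gives a sum over index maps f, in which the sum over σ assembles
the determinant of B with its columns selected by f. A non-injective f repeats a column and
contributes zero; a permutation contributes its sign times det B. -/
theorem sum_pfTerm_congruence (A B : Matrix (P × Fin 2) (P × Fin 2) ℂ) :
    ∑ σ, pfTerm (B * A * B.transpose) σ = B.det * ∑ σ, pfTerm A σ := by
  have h1 : ∀ σ : Perm (P × Fin 2), ∏ p : P, (B * A * B.transpose) (σ (p, 0)) (σ (p, 1)) =
      ∑ f : P × Fin 2 → P × Fin 2, (∏ i, B (σ i) (f i)) * ∏ p, A (f (p, 0)) (f (p, 1)) := by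
    intro σ
    have h2 : ∀ p : P, (B * A * B.transpose) (σ (p, 0)) (σ (p, 1)) =
        ∑ g : Fin 2 → P × Fin 2, (∏ a, B (σ (p, a)) (g a)) * A (g 0) (g 1) := by
      intro p
      rw [← (finTwoArrowEquiv (P × Fin 2)).symm.sum_comp, Fintype.sum_prod_type,
        Finset.sum_comm]
      simp only [Matrix.mul_apply, Matrix.transpose_apply, Finset.sum_mul]
      refine Finset.sum_congr rfl fun k _ => Finset.sum_congr rfl fun l _ => ?_
      simp [finTwoArrowEquiv, Fin.prod_univ_two]; ring
    simp_rw [h2]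
    rw [Finset.prod_univ_sum, Fintype.piFinset_univ,
      ← (Equiv.curry P (Fin 2) (P × Fin 2)).sum_comp]
    refine Finset.sum_congr rfl fun f _ => ?_
    rw [Finset.prod_mul_distrib, Fintype.prod_prod_type]
    rfl
  have h3 : ∑ σ, pfTerm (B * A * B.transpose) σ =
      ∑ f : P × Fin 2 → P × Fin 2,
        (Matrix.of fun i j => B i (f j)).det * ∏ p, A (f (p, 0)) (f (p, 1)) := by
    simp only [pfTerm, h1, Finset.mul_sum]
    rw [Finset.sum_comm]
    refine Finset.sum_congr rfl fun f _ => ?_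
    rw [Matrix.det_apply', Finset.sum_mul]
    refine Finset.sum_congr rfl fun σ _ => ?_
    simp [mul_assoc]
  rw [h3, Finset.mul_sum]
  have h4 : ∀ f : P × Fin 2 → P × Fin 2, ¬ Function.Bijective f →
      (Matrix.of fun i j => B i (f j)).det * ∏ p, A (f (p, 0)) (f (p, 1)) = 0 := by
    intro f hf
    have : ¬ Function.Injective f := fun h => hf (Finite.injective_iff_bijective.1 h)
    simp only [Function.Injective, not_forall] at this
    obtain ⟨i, j, hij, hne⟩ := this
    rw [Matrix.det_zero_of_column_eq hne (fun k => by simp [hij]), zero_mul]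
  symm
  refine Finset.sum_of_injOn (fun σ : Perm (P × Fin 2) => (σ : P × Fin 2 → P × Fin 2))
    (fun _ _ _ _ h => DFunLike.coe_injective h) (fun _ _ => by simp) ?_ ?_
  · intro f _ hf
    refine h4 f fun hb => hf ⟨Equiv.ofBijective f hb, by simp, rfl⟩
  · intro σ _
    have := Matrix.det_permute' σ B
    simp only [Matrix.submatrix, id] at this
    rw [this, pfTerm]; ring

theorem blockPf_congruence (A B : Matrix (P × Fin 2) (P × Fin 2) ℂ) :
    blockPf (B * A * B.transpose) = B.det * blockPf A := by
  unfold blockPf; rw [sum_pfTerm_congruence]; ring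

/-- The permutation exchanging two blocks. -/
def blockSwap (p q : P) : Perm (P × Fin 2) := prodCongrLeft fun _ => swap p q

/-- The permutation exchanging the two indices in every block. -/
def blockFlip : Perm (P × Fin 2) := prodCongrRight fun _ => swap 0 1

theorem pfTerm_mul_blockSwap (A : Matrix (P × Fin 2) (P × Fin 2) ℂ) (σ : Perm (P × Fin 2))
    (p q : P) : pfTerm A (σ * blockSwap p q) = pfTerm A σ := by
  unfold pfTerm blockSwap
  rw [Perm.sign_mul, Perm.sign_prodCongrLeft]
  congr 1
  · simp
  · exact Fintype.prod_equiv (swap p q) _ _ fun r => by simp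

theorem pfTerm_mul_blockFlip {A : Matrix (P × Fin 2) (P × Fin 2) ℂ} (hA : ∀ i j, A i j = -A j i)
    (σ : Perm (P × Fin 2)) : pfTerm A (σ * blockFlip) = pfTerm A σ := by
  have hs : Perm.sign (blockFlip : Perm (P × Fin 2)) = (-1) ^ Fintype.card P := by
    rw [blockFlip, Perm.sign_prodCongrRight]; simp
  have : ∀ p, A ((σ * blockFlip : Perm (P × Fin 2)) (p, 0))
      ((σ * blockFlip : Perm (P × Fin 2)) (p, 1)) =
      (-1) * A (σ (p, 0)) (σ (p, 1)) := by
    intro p; simp [blockFlip]; rw [hA]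
  unfold pfTerm
  rw [Perm.sign_mul, hs]
  simp_rw [this, Finset.prod_mul_distrib]
  simp
  rw [mul_assoc, ← mul_assoc ((-1 : ℂ) ^ _), ← mul_pow]
  simp

/-- Block swaps and the simultaneous flip of all blocks preserve `pfTerm` and act transitively on
the 2|P| positions, so the index `(o, 0)` may be assumed to sit at its own position. -/
theorem sum_pfTerm_eq_fixing {A : Matrix (P × Fin 2) (P × Fin 2) ℂ} (hA : ∀ i j, A i j = -A j i)
    (o : P) : ∑ σ, pfTerm A σ =
      2 * Fintype.card P * ∑ σ with σ (o, 0) = (o, 0), pfTerm A σ := by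
  have h1 : ∀ i : P × Fin 2, ∑ σ with σ.symm (o, 0) = i, pfTerm A σ =
      ∑ σ with σ (o, 0) = (o, 0), pfTerm A σ := by
    intro i
    obtain ⟨τ, hτ, hinv⟩ : ∃ τ : Perm (P × Fin 2), τ (o, 0) = i ∧
        ∀ σ, pfTerm A (σ * τ) = pfTerm A σ := by
      obtain ⟨q, a⟩ := i
      fin_cases a
      · exact ⟨blockSwap o q, by simp [blockSwap], fun σ => pfTerm_mul_blockSwap A σ o q⟩
      · exact ⟨blockSwap o q * blockFlip, by simp [blockSwap, blockFlip],
          fun σ => by rw [← mul_assoc, pfTerm_mul_blockFlip hA, pfTerm_mul_blockSwap]⟩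
    refine Finset.sum_equiv (Equiv.mulRight τ) (fun σ => ?_) (fun σ _ => (hinv σ).symm)
    simp only [Finset.mem_filter_univ, Equiv.symm_apply_eq, Equiv.coe_mulRight, Perm.mul_apply, hτ]
    exact eq_comm
  rw [← Finset.sum_fiberwise Finset.univ (fun σ : Perm (P × Fin 2) => σ.symm (o, 0))]
  simp_rw [h1]
  simp [mul_comm]

end Pfaffian

end PfaffianDet

namespace PfaffianDet

open Equiv

/-! ### Dependence of the Pfaffian on a single symplectic block. -/

section PfaffianExpansion

variable {P : Type} [DecidableEq P]

/-- The matrix with the standard symplectic `2 × 2` block at `p` and zeros elsewhere. -/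
def blockUnit (p : P) : Matrix (P × Fin 2) (P × Fin 2) ℂ :=
  Matrix.of fun i j => if i = (p, 0) ∧ j = (p, 1) then 1 else if i = (p, 1) ∧ j = (p, 0) then -1
    else 0

theorem blockUnit_skew (p : P) (i j : P × Fin 2) : blockUnit p i j = -blockUnit p j i := by
  simp only [blockUnit, Matrix.of_apply]
  split_ifs with h1 h2 h3 h4 h5 h6 <;> simp_all

theorem skew_add_smul {I : Type*} {A B : Matrix I I ℂ} (hA : ∀ i j, A i j = -A j i)
    (hB : ∀ i j, B i j = -B j i) (c : ℂ) (i j : I) : (A + c • B) i j = -(A + c • B) j i := by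
  simp only [Matrix.add_apply, Matrix.smul_apply, hA i j, hB i j, smul_eq_mul]
  ring

variable [Fintype P]

/-- The restriction of a matrix to the blocks other than the distinguished one. -/
abbrev dropNone (A : Matrix (Option P × Fin 2) (Option P × Fin 2) ℂ) :
    Matrix (P × Fin 2) (P × Fin 2) ℂ :=
  A.submatrix (Prod.map some id) (Prod.map some id)

/-- The indices that do not belong to the distinguished block. -/
def someIndexEquiv : P × Fin 2 ≃ {i : Option P × Fin 2 // i.1.isSome} where
  toFun i := ⟨(some i.1, i.2), rfl⟩
  invFun i := (i.1.1.get i.2, i.1.2)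
  left_inv i := by simp
  right_inv i := by simp

/-- Permutations fixing both indices of the distinguished block are exactly the extensions of
permutations of the other indices, with the same sign. -/
theorem sum_fixing_block_pfTerm (A : Matrix (Option P × Fin 2) (Option P × Fin 2) ℂ) :
    ∑ σ : Perm (Option P × Fin 2) with σ (none, 0) = (none, 0) ∧ σ (none, 1) = (none, 1),
      ((Perm.sign σ : ℤ) : ℂ) * ∏ p : P, A (σ (some p, 0)) (σ (some p, 1)) =
    ∑ σ, pfTerm (dropNone A) σ := by
  symm
  refine Finset.sum_bij (fun σ _ => σ.extendDomain someIndexEquiv) ?_ ?_ ?_ ?_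
  · intro σ _
    simp only [Finset.mem_filter_univ]
    constructor <;> exact Perm.extendDomain_apply_not_subtype _ _ (by simp)
  · intro σ _ τ _ h
    exact Perm.extendDomainHom_injective someIndexEquiv h
  · intro σ hσ
    simp only [Finset.mem_filter_univ] at hσ
    have hnone : ∀ i : Option P × Fin 2, ¬ i.1.isSome → σ i = i := by
      rintro ⟨i, a⟩ hi
      simp at hi; subst hi
      fin_cases a
      · exact hσ.1
      · exact hσ.2
    have hiff : ∀ i : Option P × Fin 2, (σ i).1.isSome ↔ i.1.isSome := by
      intro i
      constructor
      · intro h; by_contra h'; rw [hnone i h'] at h; exact h' h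
      · intro h; by_contra h'
        have := σ.injective (hnone _ h')
        rw [this] at h'; exact h' h
    refine ⟨someIndexEquiv.permCongr.symm (σ.subtypePerm hiff), Finset.mem_univ _, ?_⟩
    ext1 i
    by_cases hi : i.1.isSome
    · rw [Perm.extendDomain_apply_subtype _ someIndexEquiv (b := i) hi]
      simp [Equiv.permCongr_symm]
    · rw [Perm.extendDomain_apply_not_subtype _ someIndexEquiv (b := i) hi, hnone i hi]
  · intro σ _
    have h : ∀ p a, (σ.extendDomain someIndexEquiv) (some p, a) =
        (some (σ (p, a)).1, (σ (p, a)).2) := fun p a =>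
      Perm.extendDomain_apply_image σ someIndexEquiv (p, a)
    simp only [pfTerm, Perm.sign_extendDomain, h]
    rfl

/-- Once σ fixes `(none, 0)`, only the factor of the distinguished block can meet the perturbation,
and it does so exactly when σ also fixes `(none, 1)`. This makes the dependence on c affine. -/
theorem sum_pfTerm_add_smul_blockUnit {A : Matrix (Option P × Fin 2) (Option P × Fin 2) ℂ}
    (hA : ∀ i j, A i j = -A j i) (c : ℂ) :
    ∑ σ, pfTerm (A + c • blockUnit none) σ =
      ∑ σ, pfTerm A σ + c * (2 * (Fintype.card P + 1) * ∑ σ, pfTerm (dropNone A) σ) := by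
  have hA' := skew_add_smul hA (blockUnit_skew (none : Option P)) c
  have h1 : ∀ σ : Perm (Option P × Fin 2), σ (none, 0) = (none, 0) →
      pfTerm (A + c • blockUnit none) σ = pfTerm A σ +
        c * (if σ (none, 1) = (none, 1) then
          ((Perm.sign σ : ℤ) : ℂ) * ∏ p : P, A (σ (some p, 0)) (σ (some p, 1)) else 0) := by
    intro σ h0
    have h2 : ∀ (p : P) (a : Fin 2), σ (some p, a) ≠ (none, 0) := by
      intro p a h
      have := σ.injective (h.trans h0.symm)
      simp at this
    have h3 : ∀ p : P, (A + c • blockUnit none : Matrix _ _ ℂ) (σ (some p, 0)) (σ (some p, 1)) =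
        A (σ (some p, 0)) (σ (some p, 1)) := by
      intro p
      simp [blockUnit, h2]
    unfold pfTerm
    rw [Fintype.prod_option, Fintype.prod_option]
    simp_rw [h3]
    rw [h0]
    have h4 : ∀ x, blockUnit (none : Option P) (none, 0) x = if x = (none, 1) then 1 else 0 := by
      intro x; simp [blockUnit]
    rw [Matrix.add_apply, Matrix.smul_apply, h4]
    split_ifs with h5
    · rw [h5, smul_eq_mul]; ring
    · rw [smul_zero]; ring
  rw [sum_pfTerm_eq_fixing hA' none, sum_pfTerm_eq_fixing hA none,
    Finset.sum_congr rfl (fun σ hσ => h1 σ (by simpa using hσ)), Finset.sum_add_distrib,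
    ← Finset.mul_sum, ← Finset.sum_filter, Finset.filter_filter, sum_fixing_block_pfTerm]
  simp; ring

theorem blockPf_add_smul_blockUnit_none {A : Matrix (Option P × Fin 2) (Option P × Fin 2) ℂ}
    (hA : ∀ i j, A i j = -A j i) (c : ℂ) :
    blockPf (A + c • blockUnit none) = blockPf A + c * blockPf (dropNone A) := by
  unfold blockPf
  rw [sum_pfTerm_add_smul_blockUnit hA]
  have : ((Fintype.card P).factorial : ℂ) ≠ 0 := by exact_mod_cast Nat.factorial_ne_zero _
  have : (Fintype.card P + 1 : ℂ) ≠ 0 := by exact_mod_cast Nat.succ_ne_zero (Fintype.card P)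
  rw [Fintype.card_option, Nat.factorial_succ]
  push_cast
  field_simp
  ring

end PfaffianExpansion

end PfaffianDet

namespace PfaffianDet

open Equiv

/-! ### The square of the Pfaffian is the determinant. -/

section PfaffianSquare

variable {P : Type} [Fintype P] [DecidableEq P]

/-- The distinguished block together with the remaining indices. -/
def optionIndexEquiv : Fin 2 ⊕ (P × Fin 2) ≃ Option P × Fin 2 where
  toFun := Sum.elim (fun a => (none, a)) (fun i => (some i.1, i.2))
  invFun i := match i with
    | (none, a) => Sum.inl a
    | (some p, a) => Sum.inr (p, a)
  left_inv i := by rcases i with i | i <;> rfl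
  right_inv i := by rcases i with ⟨_ | _, _⟩ <;> rfl

theorem blockPf_eq_zero_of_row {A : Matrix (P × Fin 2) (P × Fin 2) ℂ} (i : P × Fin 2)
    (h : ∀ j, A i j = 0) (h' : ∀ j, A j i = 0) : blockPf A = 0 := by
  unfold blockPf
  rw [Finset.sum_eq_zero, mul_zero]
  intro σ _
  unfold pfTerm
  rw [Finset.prod_eq_zero (i := (σ.symm i).1) (Finset.mem_univ _), mul_zero]
  obtain ⟨⟨p, a⟩, rfl⟩ := σ.surjective i
  simp only [Equiv.symm_apply_apply]
  fin_cases a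
  · exact h _
  · exact h' _

theorem transpose_schurComplement_skew {m n : Type*} [Fintype m] (C : Matrix n m ℂ)
    {W : Matrix m m ℂ} {X : Matrix n n ℂ} (hW : W.transpose = -W) (hX : X.transpose = -X) :
    (X - C * (C * W).transpose).transpose = -(X - C * (C * W).transpose) := by
  rw [Matrix.transpose_sub, Matrix.transpose_mul, Matrix.transpose_transpose,
    Matrix.transpose_mul, hX, hW, Matrix.neg_mul, Matrix.mul_neg, Matrix.mul_assoc]
  abel

/-- The reduction of the Pfaffian to that of a Schur complement. -/
theorem blockPf_sq_of_pivot
    (ih : ∀ A : Matrix (P × Fin 2) (P × Fin 2) ℂ, (∀ i j, A i j = -A j i) → blockPf A ^ 2 = A.det)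
    {A : Matrix (Option P × Fin 2) (Option P × Fin 2) ℂ} (hA : ∀ i j, A i j = -A j i)
    (hc : A (none, 0) (none, 1) ≠ 0) : blockPf A ^ 2 = A.det := by
  set c := A (none, 0) (none, 1) with hcdef
  let e : Fin 2 ⊕ (P × Fin 2) ≃ Option P × Fin 2 := optionIndexEquiv
  let A' := A.submatrix e e
  have hself : ∀ i, A i i = 0 := fun i => by
    have := hA i i; linear_combination (1 / 2) * this
  have h11 : A'.toBlocks₁₁ = !![0, c; -c, 0] := by
    ext i j
    fin_cases i <;> fin_cases j
    · exact hself _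
    · rfl
    · exact hA _ _
    · exact hself _
  have h12 : A'.toBlocks₁₂ = -A'.toBlocks₂₁.transpose := by
    ext i j; exact hA _ _
  have h22 : A'.toBlocks₂₂.transpose = -A'.toBlocks₂₂ := by
    ext i j; exact hA _ _
  set C := A'.toBlocks₂₁ with hC
  -- The inverse of the pivot block; `S` below is the Schur complement, and `U` is unit lower
  -- triangular.
  let W : Matrix (Fin 2) (Fin 2) ℂ := !![0, -c⁻¹; c⁻¹, 0]
  have hW1 : A'.toBlocks₁₁ * W = 1 := by
    rw [h11]; ext i j; fin_cases i <;> fin_cases j <;> simp [W, Matrix.mul_apply, hc]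
  have hW2 : W * A'.toBlocks₁₁ = 1 := by
    rw [h11]; ext i j; fin_cases i <;> fin_cases j <;> simp [W, Matrix.mul_apply, hc]
  have hWt : W.transpose = -W := by
    ext i j; fin_cases i <;> fin_cases j <;> simp [W]
  let S := A'.toBlocks₂₂ - C * (C * W).transpose
  let U : Matrix (Fin 2 ⊕ (P × Fin 2)) (Fin 2 ⊕ (P × Fin 2)) ℂ := Matrix.fromBlocks 1 0 (C * W) 1
  let D := Matrix.fromBlocks A'.toBlocks₁₁ 0 0 S
  have hfac : A' = U * D * U.transpose := by
    simp only [U, D, Matrix.fromBlocks_transpose, Matrix.fromBlocks_multiply]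
    conv_lhs => rw [← Matrix.fromBlocks_toBlocks A']
    congr 1
    · simp
    · simp [h12, Matrix.transpose_mul, ← Matrix.mul_assoc, hWt, hW1]
    · simp [Matrix.mul_assoc, hW2, hC]
    · simp [Matrix.mul_assoc (C), hW2, S]
  have hUdet : U.det = 1 := by simp [U]
  have hS : ∀ i j, S i j = -S j i := by
    have : S.transpose = -S := transpose_schurComplement_skew C hWt h22
    intro i j
    exact congrFun (congrFun this j) i
  have hA2 : A = U.submatrix e.symm e.symm * D.submatrix e.symm e.symm *
      (U.submatrix e.symm e.symm).transpose := by
    rw [Matrix.transpose_submatrix, Matrix.submatrix_mul_equiv, Matrix.submatrix_mul_equiv,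
      ← hfac]
    simp [A']
  -- Viewing the pivot block as a perturbation of 0 ⊕ S gives Pf D = c Pf S, because Pf(0 ⊕ S)
  -- vanishes.
  have hD : D.submatrix e.symm e.symm =
      (Matrix.fromBlocks 0 0 0 S).submatrix e.symm e.symm + c • blockUnit none := by
    ext ⟨i, a⟩ ⟨j, b⟩
    simp only [D, h11]
    rcases i with _ | i <;> rcases j with _ | j <;> fin_cases a <;> fin_cases b <;>
      simp [e, optionIndexEquiv, blockUnit]
  have hskew : ∀ i j, (Matrix.fromBlocks 0 0 0 S).submatrix e.symm e.symm i j =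
      -(Matrix.fromBlocks 0 0 0 S).submatrix e.symm e.symm j i := by
    rintro ⟨i, a⟩ ⟨j, b⟩
    rcases i with _ | i <;> rcases j with _ | j
    · exact neg_zero.symm
    · exact neg_zero.symm
    · exact neg_zero.symm
    · exact hS _ _
  have hdrop : dropNone ((Matrix.fromBlocks 0 0 0 S).submatrix e.symm e.symm) = S := by
    ext i j; rfl
  have hzero : blockPf ((Matrix.fromBlocks 0 0 0 S).submatrix e.symm e.symm) = 0 :=
    blockPf_eq_zero_of_row (none, 0) (fun j => by rcases j with ⟨_ | _, _⟩ <;> rfl)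
      (fun j => by rcases j with ⟨_ | _, _⟩ <;> rfl)
  have hpf : blockPf A = c * blockPf S := by
    rw [hA2, blockPf_congruence, hD, blockPf_add_smul_blockUnit_none hskew, hdrop, hzero,
      Matrix.det_submatrix_equiv_self, hUdet]
    ring
  have hdet : A.det = c ^ 2 * S.det := by
    rw [hA2, Matrix.det_mul, Matrix.det_mul, Matrix.det_transpose]
    simp only [Matrix.det_submatrix_equiv_self, hUdet]
    simp only [D, Matrix.det_fromBlocks_zero₂₁, h11, Matrix.det_fin_two_of]
    ring
  rw [hpf, hdet, mul_pow, ih S hS]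

/-- A vanishing pivot is removed by adding t times the symplectic block. Both sides are continuous
in t and agree for all t but one, hence at t = 0. -/
theorem blockPf_sq_option
    (ih : ∀ A : Matrix (P × Fin 2) (P × Fin 2) ℂ, (∀ i j, A i j = -A j i) → blockPf A ^ 2 = A.det)
    {A : Matrix (Option P × Fin 2) (Option P × Fin 2) ℂ} (hA : ∀ i j, A i j = -A j i) :
    blockPf A ^ 2 = A.det := by
  have h1 : ∀ t : ℂ, t ∈ ({-A (none, 0) (none, 1)}ᶜ : Set ℂ) →
      blockPf (A + t • blockUnit none) ^ 2 = (A + t • blockUnit none).det := by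
    intro t ht
    refine blockPf_sq_of_pivot ih (skew_add_smul hA (blockUnit_skew none) t) ?_
    simp only [blockUnit, Matrix.add_apply, Matrix.smul_apply, Matrix.of_apply]
    simp only [mem_compl_iff, mem_singleton_iff] at ht
    simpa [add_eq_zero_iff_eq_neg'] using ht
  have h2 : (fun t : ℂ => blockPf (A + t • blockUnit none) ^ 2) =
      fun t => (A + t • blockUnit none).det := by
    refine Continuous.ext_on (dense_compl_singleton (-A (none, 0) (none, 1))) ?_ ?_ h1
    · simp_rw [blockPf_add_smul_blockUnit_none hA]; fun_prop
    · fun_prop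
  simpa using congrFun h2 0

theorem blockPf_sq (A : Matrix (P × Fin 2) (P × Fin 2) ℂ) (hA : ∀ i j, A i j = -A j i) :
    blockPf A ^ 2 = A.det := by
  classical
  have := Fintype.induction_empty_option
    (P := fun (α : Type) [Fintype α] => ∀ [DecidableEq α] (A : Matrix (α × Fin 2) (α × Fin 2) ℂ),
      (∀ i j, A i j = -A j i) → blockPf A ^ 2 = A.det) ?_ ?_ ?_ P
  · exact this A hA
  · intro α β _ e h _ A hA
    let _ : Fintype α := Fintype.ofEquiv β e.symm
    let _ : DecidableEq α := Classical.decEq α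
    have := h (A.submatrix (Prod.map e id) (Prod.map e id)) (fun i j => hA _ _)
    rw [blockPf_reindex] at this
    rw [this]
    exact Matrix.det_submatrix_equiv_self (e.prodCongr (Equiv.refl (Fin 2))) A
  · intro _ A _
    simp [blockPf, pfTerm, Matrix.det_isEmpty]
  · intro α _ h _ A hA
    let _ : DecidableEq α := Classical.decEq α
    have h2 := blockPf_sq_option (fun A hA => h A hA) (A := A) hA
    convert h2

end PfaffianSquare

end PfaffianDet

namespace PfaffianDet

open Equiv

/-! ### Expansion of the Pfaffian over sets of blocks. -/

section SubsetExpansion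

variable {P : Type} [Fintype P] [DecidableEq P]

/-- The restriction of a matrix to the blocks in `S`. -/
abbrev blockRestrict (S : Finset P) (A : Matrix (P × Fin 2) (P × Fin 2) ℂ) :
    Matrix (S × Fin 2) (S × Fin 2) ℂ :=
  A.submatrix (Prod.map Subtype.val id) (Prod.map Subtype.val id)

omit [Fintype P] in
theorem blockPf_restrict_insert_add_smul_blockUnit {A : Matrix (P × Fin 2) (P × Fin 2) ℂ}
    (hA : ∀ i j, A i j = -A j i) {p : P} {T : Finset P} (hp : p ∉ T) (c : ℂ) :
    blockPf (blockRestrict (insert p T) (A + c • blockUnit p)) =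
      blockPf (blockRestrict (insert p T) A) + c * blockPf (blockRestrict T A) := by
  let e := (Finset.subtypeInsertEquivOption hp).symm
  have h1 : (blockRestrict (insert p T) (A + c • blockUnit p)).submatrix
      (Prod.map e id) (Prod.map e id) =
      (blockRestrict (insert p T) A).submatrix (Prod.map e id) (Prod.map e id) +
        c • blockUnit none := by
    ext ⟨i, a⟩ ⟨j, b⟩
    have hne : ∀ q : T, (q : P) ≠ p := fun q hq => hp (hq ▸ q.2)
    rcases i with _ | i <;> rcases j with _ | j <;>
      simp [e, Finset.subtypeInsertEquivOption, blockUnit, hne]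
  have h2 : ∀ i j, (blockRestrict (insert p T) A).submatrix (Prod.map e id) (Prod.map e id) i j =
      -(blockRestrict (insert p T) A).submatrix (Prod.map e id) (Prod.map e id) j i :=
    fun _ _ => hA _ _
  rw [← blockPf_reindex e, h1, blockPf_add_smul_blockUnit_none h2, blockPf_reindex]
  rfl

omit [Fintype P] in
-- The ambient set S is kept separate from the perturbed set U so that the induction on U can also
-- be applied to S with the new block erased.
theorem blockPf_restrict_add_sum {A : Matrix (P × Fin 2) (P × Fin 2) ℂ}
    (hA : ∀ i j, A i j = -A j i) (d : P → ℂ) (U : Finset P) :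
    ∀ S : Finset P, U ⊆ S → blockPf (blockRestrict S (A + ∑ p ∈ U, d p • blockUnit p)) =
      ∑ V ∈ U.powerset, (∏ p ∈ V, d p) * blockPf (blockRestrict (S \ V) A) := by
  induction U using Finset.induction_on with
  | empty =>
    intro S _
    simp only [Finset.sum_empty, add_zero, Finset.powerset_empty, Finset.sum_singleton,
      Finset.prod_empty, one_mul]
    congr! <;> simp
  | insert p U hp ih =>
    intro S hS
    have hskew : ∀ i j, (A + ∑ p ∈ U, d p • blockUnit p) i j =
        -(A + ∑ p ∈ U, d p • blockUnit p) j i := by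
      intro i j
      simp only [Matrix.add_apply, Matrix.sum_apply, Matrix.smul_apply, hA i j, smul_eq_mul,
        neg_add, ← Finset.sum_neg_distrib]
      congr 1
      exact Finset.sum_congr rfl fun q _ => by rw [blockUnit_skew]; ring
    have hpS : p ∈ S := hS (Finset.mem_insert_self _ _)
    have hUS : U ⊆ S := (Finset.subset_insert _ _).trans hS
    have hins : insert p (S.erase p) = S := Finset.insert_erase hpS
    have h1 := blockPf_restrict_insert_add_smul_blockUnit hskew (Finset.notMem_erase p S) (d p)
    rw [hins, ih S hUS, ih (S.erase p)
      (fun q hq => Finset.mem_erase.2 ⟨fun h => hp (h ▸ hq), hUS hq⟩)] at h1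
    rw [Finset.sum_insert hp, add_comm (d p • blockUnit p), ← add_assoc, h1,
      Finset.sum_powerset_insert hp, Finset.mul_sum]
    congr 1
    refine Finset.sum_congr rfl fun V hV => ?_
    have hpV : p ∉ V := fun h => hp (Finset.mem_powerset.1 hV h)
    rw [Finset.prod_insert hpV, Finset.sdiff_insert, Finset.erase_sdiff_comm, mul_assoc]

/-- The expansion of the Pfaffian of a matrix plus a multiple of the standard symplectic
matrix in every block. -/
theorem blockPf_add_sum_smul_blockUnit {A : Matrix (P × Fin 2) (P × Fin 2) ℂ}
    (hA : ∀ i j, A i j = -A j i) (d : P → ℂ) :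
    blockPf (A + ∑ p, d p • blockUnit p) =
      ∑ V : Finset P, (∏ p ∈ V, d p) * blockPf (blockRestrict Vᶜ A) := by
  have h := blockPf_restrict_add_sum hA d Finset.univ Finset.univ subset_rfl
  rw [Finset.powerset_univ] at h
  rw [← blockPf_reindex (Equiv.subtypeUnivEquiv (fun p : P => Finset.mem_univ p))]
  exact h

end SubsetExpansion

/-! ### Symmetric rank-one perturbations of skew matrices. -/

section RankOne

variable {I : Type*} [Fintype I] [DecidableEq I]

theorem det_eq_zero_of_skew_odd {B : Matrix I I ℂ} (hB : ∀ i j, B i j = -B j i)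
    (hI : Odd (Fintype.card I)) : B.det = 0 := by
  have h1 : B.transpose = -B := by ext i j; exact hB _ _
  have h2 := B.det_transpose
  rw [h1, Matrix.det_neg, hI.neg_one_pow] at h2
  linear_combination (-1 / 2) * h2

/-- Adding a symmetric matrix of rank one does not change the determinant of a skew-symmetric
matrix of even size. -/
theorem det_skew_add_vecMulVec {B : Matrix I I ℂ} (hB : ∀ i j, B i j = -B j i)
    (hI : Even (Fintype.card I)) (u : I → ℂ) : (B + Matrix.vecMulVec u u).det = B.det := by
  -- Bordered matrix whose determinant is affine in the corner t with slope det B. At t = 0 it is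
  -- skew of odd size, hence singular; at t = 1 its Schur complement is B + u uᵀ.
  let R (t : ℂ) : Matrix (I ⊕ Unit) (I ⊕ Unit) ℂ := Matrix.fromBlocks B
    (Matrix.replicateCol Unit u) (-Matrix.replicateRow Unit u) (Matrix.of fun _ _ => t)
  have h0 : (R 0).det = 0 := by
    refine det_eq_zero_of_skew_odd ?_ ?_
    · rintro (i | i) (j | j) <;> simp [R]
      exact hB _ _
    · simpa using hI.add_one
  have h1 : (R 1).det = (B + Matrix.vecMulVec u u).det := by
    have : (Matrix.of fun _ _ => (1 : ℂ) : Matrix Unit Unit ℂ) = 1 := by ext; simp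
    simp only [R, this, Matrix.det_fromBlocks_one₂₂]
    congr 1
    ext i j
    simp [Matrix.vecMulVec_apply, Matrix.mul_apply]
  have h2 : (R 1).det = (R 0).det + B.det := by
    have hrow : R 1 = (R 0).updateRow (Sum.inr ())
        ((R 0) (Sum.inr ()) + Sum.elim (0 : I → ℂ) (1 : Unit → ℂ)) := by
      ext i j
      rcases i with i | i <;> rcases j with j | j <;> simp [R, Matrix.updateRow_apply]
    have hrow2 : (R 0).updateRow (Sum.inr ()) (Sum.elim (0 : I → ℂ) (1 : Unit → ℂ)) =
        Matrix.fromBlocks B (Matrix.replicateCol Unit u) 0 1 := by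
      ext i j
      rcases i with i | i <;> rcases j with j | j <;> simp [R, Matrix.updateRow_apply]
    rw [hrow, Matrix.det_updateRow_add, Matrix.updateRow_eq_self, hrow2]
    simp
  rw [← h1, h2, h0, zero_add]

end RankOne

end PfaffianDet

namespace PfaffianDet

open Equiv

/-! ### Sign averaging: products of complementary Pfaffians as minors. -/

section Averaging

variable {P : Type} [Fintype P] [DecidableEq P]

theorem prod_finset_eq_prod_ite (V : Finset P) (f : P → ℂ) :
    ∏ p ∈ V, f p = ∏ p, if p ∈ V then f p else 1 := by
  simp [Finset.prod_ite_mem]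

theorem sum_units_prod (h : P → ℤˣ → ℂ) :
    ∑ ε : P → ℤˣ, ∏ p, h p (ε p) = ∏ p, (h p 1 + h p (-1)) := by
  have h1 : ∀ p, h p 1 + h p (-1) = ∑ e : ℤˣ, h p e := fun p => by
    rw [show (Finset.univ : Finset ℤˣ) = {1, -1} from rfl, Finset.sum_pair (by decide)]
  simp_rw [h1]
  rw [Finset.prod_univ_sum, Fintype.piFinset_univ]

/-- The sum factors over p, where ε p carries the exponent 1 + [p ∈ V] + [p ∈ W]. A factor vanishes
when this is odd, so p must lie in exactly one of V and W. -/
theorem sum_sign_average_subsets (V W : Finset P) :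
    ∑ ε : P → ℤˣ, (∏ p, ((ε p : ℤ) : ℂ)) *
        ((∏ p ∈ V, ((ε p : ℤ) : ℂ)) * ∏ p ∈ W, ((ε p : ℤ) : ℂ)) =
      if W = Vᶜ then 2 ^ Fintype.card P else 0 := by
  have h1 : ∀ ε : P → ℤˣ, (∏ p, ((ε p : ℤ) : ℂ)) *
        ((∏ p ∈ V, ((ε p : ℤ) : ℂ)) * ∏ p ∈ W, ((ε p : ℤ) : ℂ)) =
      ∏ p, (fun p (e : ℤˣ) => ((e : ℤ) : ℂ) * ((if p ∈ V then ((e : ℤ) : ℂ) else 1) *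
        (if p ∈ W then ((e : ℤ) : ℂ) else 1))) p (ε p) := by
    intro ε
    rw [prod_finset_eq_prod_ite V, prod_finset_eq_prod_ite W, ← Finset.prod_mul_distrib,
      ← Finset.prod_mul_distrib]
  rw [Finset.sum_congr rfl fun ε _ => h1 ε, sum_units_prod (fun p (e : ℤˣ) =>
    ((e : ℤ) : ℂ) * ((if p ∈ V then ((e : ℤ) : ℂ) else 1) *
      (if p ∈ W then ((e : ℤ) : ℂ) else 1)))]
  split_ifs with h
  · subst h
    rw [← Finset.card_univ, ← Finset.prod_const]
    refine Finset.prod_congr rfl fun p _ => ?_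
    by_cases hp : p ∈ V <;> simp [hp] <;> norm_num
  · have : ∃ p, ¬ (p ∈ W ↔ p ∈ Vᶜ) := by
      by_contra hc; push Not at hc; exact h (Finset.ext hc)
    obtain ⟨p, hp⟩ := this
    refine Finset.prod_eq_zero (Finset.mem_univ p) ?_
    rw [Finset.mem_compl] at hp
    by_cases hV : p ∈ V <;> by_cases hW : p ∈ W <;> simp_all

theorem sum_sign_average_sq (g : Finset P → ℂ) :
    ∑ ε : P → ℤˣ, (∏ p, ((ε p : ℤ) : ℂ)) * (∑ V, (∏ p ∈ V, ((ε p : ℤ) : ℂ)) * g V) ^ 2 =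
      2 ^ Fintype.card P * ∑ V, g V * g Vᶜ := by
  have h1 : ∀ ε : P → ℤˣ,
      (∏ p, ((ε p : ℤ) : ℂ)) * (∑ V, (∏ p ∈ V, ((ε p : ℤ) : ℂ)) * g V) ^ 2 =
      ∑ V, ∑ W, (g V * g W) * ((∏ p, ((ε p : ℤ) : ℂ)) *
        ((∏ p ∈ V, ((ε p : ℤ) : ℂ)) * ∏ p ∈ W, ((ε p : ℤ) : ℂ))) := by
    intro ε
    rw [sq, Finset.sum_mul_sum, Finset.mul_sum]
    refine Finset.sum_congr rfl fun V _ => ?_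
    rw [Finset.mul_sum]
    exact Finset.sum_congr rfl fun W _ => by ring
  simp_rw [h1]
  rw [Finset.sum_comm]
  simp_rw [Finset.sum_comm (s := (Finset.univ : Finset (P → ℤˣ))), ← Finset.mul_sum,
    sum_sign_average_subsets]
  simp [Finset.mul_sum, mul_comm]

/-- The rows of `M` with the rows indexed by `T` replaced by those of the identity matrix. -/
noncomputable def unitRows {I : Type*} [DecidableEq I] (T : Finset I) (M : Matrix I I ℂ) :
    Matrix I I ℂ :=
  Matrix.of (T.piecewise (1 : Matrix I I ℂ) M)

/-- Multilinearity in the rows: T records the rows taken from the diagonal part. -/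
theorem det_diagonal_add {I : Type*} [Fintype I] [DecidableEq I] (d : I → ℂ) (M : Matrix I I ℂ) :
    (Matrix.diagonal d + M).det = ∑ T : Finset I, (∏ i ∈ T, d i) * (unitRows T M).det := by
  have h := (Matrix.detRowAlternating (n := I) (R := ℂ)).toMultilinearMap.map_add_univ
    (fun i => d i • (1 : Matrix I I ℂ) i) M
  have h0 : (Matrix.diagonal d + M).det = Matrix.detRowAlternating.toMultilinearMap
      ((fun i => d i • (1 : Matrix I I ℂ) i) + fun i => M i) := by
    show Matrix.detRowAlternating _ = Matrix.detRowAlternating _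
    congr 1
    ext i j
    simp [Matrix.diagonal_apply, Matrix.one_apply]
  refine h0.trans <| h.trans (Finset.sum_congr rfl fun T _ => ?_)
  have h2 := (Matrix.detRowAlternating (n := I) (R := ℂ)).toMultilinearMap.map_piecewise_smul
    d (T.piecewise (1 : Matrix I I ℂ) M) T
  rw [smul_eq_mul] at h2
  refine Eq.trans ?_ h2
  congr 1
  funext i
  by_cases hi : i ∈ T
  · simp only [Finset.piecewise, if_pos hi]
  · simp only [Finset.piecewise, if_neg hi]

theorem sum_sign_average_index_subset (T : Finset (P × Fin 2)) :
    ∑ ε : P → ℤˣ, (∏ p, ((ε p : ℤ) : ℂ)) * (∏ i ∈ T, ((ε i.1 : ℤ) : ℂ)) =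
      if ∀ p, ((p, 1) ∈ T ↔ (p, 0) ∉ T) then 2 ^ Fintype.card P else 0 := by
  have h1 : ∀ ε : P → ℤˣ, (∏ i ∈ T, ((ε i.1 : ℤ) : ℂ)) =
      (∏ p with (p, 0) ∈ T, ((ε p : ℤ) : ℂ)) * ∏ p with (p, 1) ∈ T, ((ε p : ℤ) : ℂ) := by
    intro ε
    have h2 : ∏ i ∈ T, ((ε i.1 : ℤ) : ℂ) = ∏ i, if i ∈ T then ((ε i.1 : ℤ) : ℂ) else 1 :=
      prod_finset_eq_prod_ite T fun i : P × Fin 2 => ((ε i.1 : ℤ) : ℂ)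
    rw [h2, Fintype.prod_prod_type, Finset.prod_filter, Finset.prod_filter,
      ← Finset.prod_mul_distrib]
    simp only [Fin.prod_univ_two]
  simp_rw [h1]
  rw [sum_sign_average_subsets]
  congr 1
  simp [Finset.ext_iff]

/-- The rows indexed by `(p, a)` with `a ≠ s p`. -/
def offSection (s : P → Fin 2) : Finset (P × Fin 2) := {i | i.2 ≠ s i.1}

/-- With the graph of s as one block, the matrix is block triangular and its other diagonal block is
the identity. -/
theorem det_unitRows_offSection (s : P → Fin 2) (M : Matrix (P × Fin 2) (P × Fin 2) ℂ) :
    (unitRows (offSection s) M).det = (Matrix.of fun p q => M (p, s p) (q, s q)).det := by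
  have hrow : ∀ i : P × Fin 2, i.2 ≠ s i.1 → ∀ j, unitRows (offSection s) M i j =
      (1 : Matrix _ _ ℂ) i j := by
    intro i hi j
    simp [unitRows, offSection, Finset.piecewise, hi]
  have hrow' : ∀ i : P × Fin 2, i.2 = s i.1 → ∀ j, unitRows (offSection s) M i j = M i j := by
    intro i hi j
    simp [unitRows, offSection, Finset.piecewise, hi]
  rw [Matrix.twoBlockTriangular_det (unitRows (offSection s) M) (fun i => i.2 = s i.1)
    (fun i hi j hj => by
      rw [hrow i hi, Matrix.one_apply_ne]
      rintro rfl; exact hi hj)]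
  have h1 : (unitRows (offSection s) M).toSquareBlockProp (fun i => ¬ i.2 = s i.1) = 1 := by
    ext i j
    rw [Matrix.toSquareBlockProp_def, Matrix.of_apply, hrow _ i.2]
    simp [Matrix.one_apply, Subtype.ext_iff]
  rw [h1, Matrix.det_one, mul_one]
  let e : P ≃ {i : P × Fin 2 // i.2 = s i.1} :=
    { toFun := fun p => ⟨(p, s p), rfl⟩
      invFun := fun i => i.1.1
      left_inv := fun p => rfl
      right_inv := by rintro ⟨⟨p, a⟩, h⟩; simp at h; subst h; rfl }
  rw [← Matrix.det_submatrix_equiv_self e]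
  congr 1
  ext p q
  exact hrow' _ rfl _

/-- Averaging keeps only the sets T containing exactly one index of every block, and these are the
complements of graphs of sections s. -/
theorem sum_sign_average_det (M : Matrix (P × Fin 2) (P × Fin 2) ℂ) :
    ∑ ε : P → ℤˣ, (∏ p, ((ε p : ℤ) : ℂ)) *
        (Matrix.diagonal (fun i : P × Fin 2 => ((ε i.1 : ℤ) : ℂ)) + M).det =
      2 ^ Fintype.card P * ∑ s : P → Fin 2, (Matrix.of fun p q => M (p, s p) (q, s q)).det := by
  simp_rw [det_diagonal_add, Finset.mul_sum]
  rw [Finset.sum_comm]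
  simp_rw [← mul_assoc, ← Finset.sum_mul, sum_sign_average_index_subset]
  symm
  refine Finset.sum_of_injOn offSection ?_ (fun _ _ => by simp) ?_ ?_
  · intro s _ t _ h
    funext p
    by_contra hne
    have h1 : (p, t p) ∈ offSection s := by simpa [offSection] using Ne.symm hne
    rw [h] at h1
    simp [offSection] at h1
  · intro T _ hT
    rw [if_neg, zero_mul]
    intro h
    refine hT ⟨fun p => if (p, 0) ∈ T then 1 else 0, by simp, ?_⟩
    ext ⟨p, a⟩
    have := h p
    fin_cases a <;> by_cases h0 : (p, 0) ∈ T <;> simp_all [offSection]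
  · intro s _
    rw [det_unitRows_offSection, if_pos]
    intro p
    have : s p = 0 ∨ s p = 1 := by omega
    rcases this with h | h <;> simp [offSection, h]

/-- Left multiplication by the transpose of the standard symplectic matrix. -/
def symplecticRows (N : Matrix (P × Fin 2) (P × Fin 2) ℂ) : Matrix (P × Fin 2) (P × Fin 2) ℂ :=
  Matrix.of fun i j => if i.2 = 0 then -N (i.1, 1) j else N (i.1, 0) j

theorem det_symplecticRows (N : Matrix (P × Fin 2) (P × Fin 2) ℂ) :
    (symplecticRows N).det = N.det := by
  let j2 : Matrix (Fin 2) (Fin 2) ℂ := !![0, -1; 1, 0]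
  let J : Matrix (P × Fin 2) (P × Fin 2) ℂ :=
    (Matrix.blockDiagonal fun _ : P => j2).submatrix (Equiv.prodComm _ _) (Equiv.prodComm _ _)
  have h1 : symplecticRows N = J * N := by
    ext ⟨p, a⟩ j
    simp only [symplecticRows, J, Matrix.mul_apply, Fintype.sum_prod_type, Matrix.of_apply,
      Matrix.submatrix_apply, Matrix.blockDiagonal_apply]
    fin_cases a <;> simp [j2]
  have h2 : J.det = 1 := by
    rw [Matrix.det_submatrix_equiv_self, Matrix.det_blockDiagonal]
    simp [j2]
  rw [h1, Matrix.det_mul, h2, one_mul]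

/-- The sum over complementary pairs of principal sub-Pfaffians of a skew-symmetric matrix as a
sum of minors, in which the matrix may be modified by a symmetric matrix of rank one. -/
theorem sum_blockPf_mul_blockPf_compl {K : Matrix (P × Fin 2) (P × Fin 2) ℂ}
    (hK : ∀ i j, K i j = -K j i) (u : P × Fin 2 → ℂ) :
    ∑ V : Finset P, blockPf (blockRestrict V K) * blockPf (blockRestrict Vᶜ K) =
      ∑ s : P → Fin 2, (Matrix.of fun p q =>
        symplecticRows (K + Matrix.vecMulVec u u) (p, s p) (q, s q)).det := by
  have h2 : (2 : ℂ) ^ Fintype.card P ≠ 0 := pow_ne_zero _ two_ne_zero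
  refine mul_left_cancel₀ h2 ?_
  rw [← sum_sign_average_det]
  have h3 := sum_sign_average_sq (fun V => blockPf (blockRestrict Vᶜ K))
  have h4 : ∑ V : Finset P, blockPf (blockRestrict V K) * blockPf (blockRestrict Vᶜ K) =
      ∑ V : Finset P, blockPf (blockRestrict Vᶜ K) * blockPf (blockRestrict Vᶜᶜ K) := by
    exact (Equiv.sum_comp (Function.Involutive.toPerm compl (compl_involutive (α := Finset P)))
      fun V => blockPf (blockRestrict V K) * blockPf (blockRestrict Vᶜ K)).symm
  rw [h4, ← h3]
  refine Finset.sum_congr rfl fun ε _ => ?_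
  congr 1
  rw [← blockPf_add_sum_smul_blockUnit hK]
  have hskew : ∀ i j, (K + ∑ p, ((ε p : ℤ) : ℂ) • blockUnit p) i j =
      -(K + ∑ p, ((ε p : ℤ) : ℂ) • blockUnit p) j i := by
    intro i j
    simp only [Matrix.add_apply, Matrix.sum_apply, Matrix.smul_apply, hK i j, smul_eq_mul,
      neg_add, ← Finset.sum_neg_distrib]
    congr 1
    exact Finset.sum_congr rfl fun q _ => by rw [blockUnit_skew]; ring
  -- The rank-one term is free here, and the row operation turns each symplectic block into an
  -- identity block, so the signs end up on the diagonal.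
  rw [blockPf_sq _ hskew, ← det_skew_add_vecMulVec hskew (by simp) u, ← det_symplecticRows]
  congr 1
  ext ⟨p, a⟩ ⟨q, b⟩
  simp only [symplecticRows, Matrix.add_apply, Matrix.sum_apply, Matrix.smul_apply,
    Matrix.of_apply, blockUnit, Matrix.diagonal_apply]
  have hs : ∀ f : P → ℂ, (∑ x, if p = x ∧ q = x then f x else 0) = if p = q then f p else 0 := by
    intro f
    simp_rw [ite_and]
    simp [eq_comm]
  fin_cases a <;> fin_cases b <;> simp [Prod.ext_iff, eq_comm, hs]
  · split_ifs
    · simp; ring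
    · simp
  · ring

end Averaging

end PfaffianDet

namespace PfaffianDet

/-! ### Hadamard's inequality. -/

section Hadamard

/-- Passing to the Gram-Schmidt basis costs a determinant of modulus one and makes the coordinates
triangular, leaving a product of inner products with unit vectors. -/
theorem norm_orthonormalBasis_det_le {F : Type*} [NormedAddCommGroup F] [InnerProductSpace ℂ F]
    {n : ℕ} (b : OrthonormalBasis (Fin n) ℂ F) (v : Fin n → F) :
    ‖b.toBasis.det v‖ ≤ ∏ i, ‖v i‖ := by
  have : FiniteDimensional ℂ F := b.toBasis.finiteDimensional_of_finite
  have hdim : Module.finrank ℂ F = Fintype.card (Fin n) :=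
    Module.finrank_eq_card_basis b.toBasis
  let G := InnerProductSpace.gramSchmidtOrthonormalBasis hdim v
  have h1 : b.toBasis.det v = b.toBasis.det G * G.toBasis.det v := by
    have := congrArg (fun f => f v) (AlternatingMap.eq_smul_basis_det G.toBasis b.toBasis.det)
    simpa using this
  rw [h1, norm_mul, OrthonormalBasis.det_to_matrix_orthonormalBasis, one_mul,
    InnerProductSpace.gramSchmidtOrthonormalBasis_det, norm_prod]
  refine Finset.prod_le_prod (fun _ _ => norm_nonneg _) fun i _ => ?_
  refine (norm_inner_le_norm _ _).trans ?_
  simp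

/-- If b is independent, a may be projected onto its span, where the matrix factors through
orthonormal coordinates of a and b. If b is dependent, the determinant vanishes. -/
theorem norm_det_inner_fin_le {E : Type*} [NormedAddCommGroup E] [InnerProductSpace ℂ E]
    {n : ℕ} (a b : Fin n → E) :
    ‖(Matrix.of fun i j => inner ℂ (a i) (b j)).det‖ ≤ (∏ i, ‖a i‖) * ∏ j, ‖b j‖ := by
  by_cases hb : LinearIndependent ℂ b
  · let F := Submodule.span ℂ (Set.range b)
    have : FiniteDimensional ℂ F := FiniteDimensional.span_of_finite ℂ (Set.finite_range b)
    have hdim : Module.finrank ℂ F = n := by simpa using finrank_span_eq_card hb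
    let e : OrthonormalBasis (Fin n) ℂ F := (stdOrthonormalBasis ℂ F).reindex (finCongr hdim)
    let a' : Fin n → F := fun i => F.orthogonalProjectionOnto (a i)
    let b' : Fin n → F := fun j => ⟨b j, Submodule.subset_span ⟨j, rfl⟩⟩
    have h1 : (Matrix.of fun i j => inner ℂ (a i) (b j)) =
        (e.toBasis.toMatrix a').conjTranspose * e.toBasis.toMatrix b' := by
      ext i j
      have : inner ℂ (a i) (b j) = inner ℂ (a' i) (b' j) :=
        (Submodule.inner_orthogonalProjectionOnto_eq_of_mem_right (b' j) (a i)).symm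
      rw [Matrix.of_apply, this, ← e.sum_inner_mul_inner]
      simp [Matrix.mul_apply, Module.Basis.toMatrix_apply, OrthonormalBasis.repr_apply_apply]
    rw [h1, Matrix.det_mul, Matrix.det_conjTranspose, norm_mul, norm_star]
    have h2 := norm_orthonormalBasis_det_le e a'
    have h3 := norm_orthonormalBasis_det_le e b'
    rw [Module.Basis.det_apply] at h2 h3
    refine mul_le_mul (h2.trans ?_) h3 (norm_nonneg _) (by positivity)
    refine Finset.prod_le_prod (fun _ _ => norm_nonneg _) fun i _ => ?_
    exact Submodule.norm_orthogonalProjectionOnto_apply_le _ _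
  · rw [Fintype.not_linearIndependent_iff] at hb
    obtain ⟨c, hc, i, hi⟩ := hb
    have : (Matrix.of fun i j => inner ℂ (a i) (b j)).det = 0 := by
      rw [← Matrix.exists_mulVec_eq_zero_iff]
      refine ⟨c, fun h => hi (congrFun h i), ?_⟩
      ext k
      have := congrArg (inner ℂ (a k)) hc
      rw [inner_sum] at this
      simpa [Matrix.mulVec, dotProduct, inner_smul_right, mul_comm] using this
    rw [this, norm_zero]
    positivity

/-- Hadamard's inequality for a matrix of inner products. -/
theorem norm_det_inner_le {E I : Type*} [NormedAddCommGroup E] [InnerProductSpace ℂ E]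
    [Fintype I] [DecidableEq I] (a b : I → E) :
    ‖(Matrix.of fun i j => inner ℂ (a i) (b j)).det‖ ≤ (∏ i, ‖a i‖) * ∏ j, ‖b j‖ := by
  let e := Fintype.equivFin I
  have h := norm_det_inner_fin_le (a ∘ e.symm) (b ∘ e.symm)
  rw [← Matrix.det_submatrix_equiv_self e.symm, ← e.symm.prod_comp fun i => ‖a i‖,
    ← e.symm.prod_comp fun i => ‖b i‖]
  exact h

end Hadamard

end PfaffianDet

namespace PfaffianDet

/-! ### Andréief's identity for Hilbert-Schmidt kernels. -/

section Andreief

theorem memLp_two_section {R X : Type*} [MeasurableSpace R] [MeasurableSpace X]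
    {ν : Measure R} {m : Measure X} [SFinite ν] [SFinite m] {f : R × X → ℂ}
    (hf : MemLp f 2 (ν.prod m)) : ∀ᵐ r ∂ν, MemLp (fun x => f (r, x)) 2 m := by
  have h1 := ((memLp_two_iff_integrable_sq_norm hf.1).1 hf).prod_right_ae
  filter_upwards [h1, hf.1.prodMk_left] with r hr hr'
  exact (memLp_two_iff_integrable_sq_norm hr').2 hr

theorem memLp_two_section_swap {R X : Type*} [MeasurableSpace R] [MeasurableSpace X]
    {ν : Measure R} {m : Measure X} [SFinite ν] [SFinite m] {f : R × X → ℂ}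
    (hf : MemLp f 2 (ν.prod m)) : ∀ᵐ x ∂m, MemLp (fun r => f (r, x)) 2 ν :=
  memLp_two_section (f := f ∘ Prod.swap)
    (hf.comp_measurePreserving Measure.measurePreserving_swap)

variable {I : Type} [Fintype I]

theorem ae_pi_forall {Y : Type*} [MeasurableSpace Y] {μ : Measure Y} [SigmaFinite μ]
    {p : I → Y → Prop} (h : ∀ i, ∀ᵐ y ∂μ, p i y) :
    ∀ᵐ y : I → Y ∂(Measure.pi fun _ => μ), ∀ i, p i (y i) := by
  rw [ae_all_iff]
  exact fun i => (Measure.quasiMeasurePreserving_eval (fun _ : I => μ) i).ae (h i)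

theorem memLp_two_pi_prod {Y : Type*} [MeasurableSpace Y] {μ : Measure Y} [SigmaFinite μ]
    {f : I → Y → ℂ} (hf : ∀ i, MemLp (f i) 2 μ) :
    MemLp (fun y : I → Y => ∏ i, f i (y i)) 2 (Measure.pi fun _ => μ) := by
  have h1 : AEStronglyMeasurable (fun y : I → Y => ∏ i, f i (y i)) (Measure.pi fun _ => μ) :=
    Finset.aestronglyMeasurable_fun_prod _ fun i _ =>
      (hf i).1.comp_quasiMeasurePreserving (Measure.quasiMeasurePreserving_eval (fun _ => μ) i)
  rw [memLp_two_iff_integrable_sq_norm h1]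
  simp_rw [norm_prod, ← Finset.prod_pow]
  exact Integrable.fintype_prod (f := fun i y => ‖f i y‖ ^ 2)
    fun i => (memLp_two_iff_integrable_sq_norm (hf i).1).1 (hf i)

theorem memLp_two_prod_pi {R X : Type*} [MeasurableSpace R] [MeasurableSpace X]
    {ν : Measure R} {m : Measure X} [SigmaFinite ν] [SigmaFinite m] {f : I → R × X → ℂ}
    (hf : ∀ i, MemLp (f i) 2 (ν.prod m)) :
    MemLp (fun y : (I → R) × (I → X) => ∏ i, f i (y.1 i, y.2 i)) 2
      ((Measure.pi fun _ => ν).prod (Measure.pi fun _ => m)) :=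
  (memLp_two_pi_prod hf).comp_measurePreserving
    (measurePreserving_arrowProdEquivProdArrow R X I (fun _ => ν) (fun _ => m)).symm

theorem measurePreserving_comp_equiv {J : Type} [Fintype J] {Y : Type*} [MeasurableSpace Y]
    (μ : Measure Y) [SigmaFinite μ] (e : I ≃ J) :
    MeasurePreserving (fun y : J → Y => y ∘ e) (Measure.pi fun _ => μ) (Measure.pi fun _ => μ) := by
  convert measurePreserving_piCongrLeft (fun _ : I => μ) e.symm using 1
  funext y i
  obtain ⟨j, rfl⟩ := e.symm.surjective i
  rw [MeasurableEquiv.coe_piCongrLeft, Equiv.piCongrLeft_apply_apply]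
  simp

theorem integrable_det_rows {Y : Type*} [MeasurableSpace Y] {μ : Measure Y} [SigmaFinite μ]
    {h : I → I → Y → ℂ} (hh : ∀ p q, Integrable (h p q) μ) (σ : Equiv.Perm I) :
    Integrable (fun y : I → Y => ∏ p, h p (σ p) (y p)) (Measure.pi fun _ => μ) :=
  Integrable.fintype_prod fun p => hh p (σ p)

variable [DecidableEq I]

/-- Each row has its own variable, so every Leibniz term is a product of functions of distinct
variables. -/
theorem integral_det_rows {Y : Type*} [MeasurableSpace Y] {μ : Measure Y} [SigmaFinite μ]
    {h : I → I → Y → ℂ} (hh : ∀ p q, Integrable (h p q) μ) :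
    ∫ y : I → Y, (Matrix.of fun p q => h p q (y p)).det ∂(Measure.pi fun _ => μ) =
      (Matrix.of fun p q => ∫ y, h p q y ∂μ).det := by
  simp_rw [← Matrix.det_transpose (Matrix.of _), Matrix.det_apply']
  rw [integral_finsetSum]
  · refine Finset.sum_congr rfl fun σ _ => ?_
    rw [integral_const_mul]
    congr 1
    exact integral_fintype_prod_eq_prod (fun p y => h p (σ p) y)
  · intro σ _
    exact (integrable_det_rows hh σ).const_mul _

variable {R X : Type*} [MeasurableSpace R] [MeasurableSpace X]
    {ν : Measure R} {m : Measure X} [SigmaFinite ν] [SigmaFinite m] {α β : I → R × X → ℂ}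

/-- Each Leibniz term pairs two L² product functions, the second with its x-coordinates permuted,
which preserves the measure. This integrability justifies the exchange of integrals in Andréief's
identity. -/
theorem integrable_prod_mul_det (hα : ∀ i, MemLp (α i) 2 (ν.prod m))
    (hβ : ∀ i, MemLp (β i) 2 (ν.prod m)) :
    Integrable (fun y : (I → R) × (I → X) => (∏ i, α i (y.1 i, y.2 i)) *
      (Matrix.of fun p q => β p (y.1 p, y.2 q)).det)
      ((Measure.pi fun _ => ν).prod (Measure.pi fun _ => m)) := by
  simp_rw [← Matrix.det_transpose (Matrix.of _), Matrix.det_apply', Finset.mul_sum]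
  refine integrable_finsetSum _ fun σ _ => ?_
  simp_rw [mul_left_comm _ ((Equiv.Perm.sign σ : ℤ) : ℂ)]
  refine Integrable.const_mul ?_ _
  have h1 := memLp_two_prod_pi hβ
  have h2 : MeasurePreserving (fun y : (I → R) × (I → X) => (y.1, y.2 ∘ σ))
      ((Measure.pi fun _ => ν).prod (Measure.pi fun _ => m))
      ((Measure.pi fun _ => ν).prod (Measure.pi fun _ => m)) :=
    (MeasurePreserving.id _).prod (measurePreserving_comp_equiv m σ)
  exact (memLp_two_prod_pi hα).integrable_mul (h1.comp_measurePreserving h2)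

theorem integral_prod_mul_det_left (hα : ∀ i, MemLp (α i) 2 (ν.prod m))
    (hβ : ∀ i, MemLp (β i) 2 (ν.prod m)) :
    ∀ᵐ x : I → X ∂(Measure.pi fun _ => m),
      ∫ r : I → R, (∏ i, α i (r i, x i)) * (Matrix.of fun p q => β p (r p, x q)).det
        ∂(Measure.pi fun _ => ν) =
      (Matrix.of fun p q => ∫ r, α p (r, x p) * β p (r, x q) ∂ν).det := by
  have h1 := ae_pi_forall (I := I) (μ := m) (p := fun _ x => ∀ p, MemLp (fun r => α p (r, x)) 2 ν ∧
    MemLp (fun r => β p (r, x)) 2 ν) fun _ => by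
      rw [ae_all_iff]
      intro p
      filter_upwards [memLp_two_section_swap (hα p), memLp_two_section_swap (hβ p)] with x h h'
      exact ⟨h, h'⟩
  filter_upwards [h1] with x hx
  rw [← integral_det_rows (h := fun p q r => α p (r, x p) * β p (r, x q))
    fun p q => (hx p p).1.integrable_mul (hx q p).2]
  congr 1
  funext r
  exact (Matrix.det_mul_column (fun p => α p (r p, x p)) _).symm

theorem integral_prod_mul_det_right (hα : ∀ i, MemLp (α i) 2 (ν.prod m))
    (hβ : ∀ i, MemLp (β i) 2 (ν.prod m)) :
    ∀ᵐ r : I → R ∂(Measure.pi fun _ => ν),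
      ∫ x : I → X, (∏ i, α i (r i, x i)) * (Matrix.of fun p q => β p (r p, x q)).det
        ∂(Measure.pi fun _ => m) =
      (Matrix.of fun p q => ∫ x, α p (r p, x) * β q (r q, x) ∂m).det := by
  have h1 := ae_pi_forall (I := I) (μ := ν) (p := fun _ r => ∀ p, MemLp (fun x => α p (r, x)) 2 m ∧
    MemLp (fun x => β p (r, x)) 2 m) fun _ => by
      rw [ae_all_iff]
      intro p
      filter_upwards [memLp_two_section (hα p), memLp_two_section (hβ p)] with x h h'
      exact ⟨h, h'⟩
  filter_upwards [h1] with r hr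
  rw [← integral_det_rows (h := fun p q x => α p (r p, x) * β q (r q, x))
    fun p q => (hr p p).1.integrable_mul (hr q q).2]
  congr 1
  funext x
  rw [← Matrix.det_transpose]
  exact (Matrix.det_mul_column (fun p => α p (r p, x p)) _).symm

/-- Andréief's identity for kernels on a product space: the minors of the two ways of composing
a pair of kernels have the same integral. -/
theorem integral_det_comp_eq (hα : ∀ i, MemLp (α i) 2 (ν.prod m))
    (hβ : ∀ i, MemLp (β i) 2 (ν.prod m)) :
    Integrable (fun x : I → X => (Matrix.of fun p q => ∫ r, α p (r, x p) * β p (r, x q) ∂ν).det)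
      (Measure.pi fun _ => m) ∧
    Integrable (fun r : I → R => (Matrix.of fun p q => ∫ x, α p (r p, x) * β q (r q, x) ∂m).det)
      (Measure.pi fun _ => ν) ∧
    ∫ x : I → X, (Matrix.of fun p q => ∫ r, α p (r, x p) * β p (r, x q) ∂ν).det
      ∂(Measure.pi fun _ => m) =
    ∫ r : I → R, (Matrix.of fun p q => ∫ x, α p (r p, x) * β q (r q, x) ∂m).det
      ∂(Measure.pi fun _ => ν) := by
  have h := integrable_prod_mul_det hα hβ
  have h1 := integral_prod_mul_det_left hα hβ
  have h2 := integral_prod_mul_det_right hα hβ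
  refine ⟨h.integral_prod_right.congr h1, h.integral_prod_left.congr h2, ?_⟩
  rw [← integral_congr_ae h1, ← integral_congr_ae h2]
  exact (integral_integral_swap h).symm

end Andreief

end PfaffianDet

namespace PfaffianDet

open Filter Topology

/-! ### Laplace-type integrals: continuity, decay and derivative. -/

section Laplace

variable {Y : Type*} [MeasurableSpace Y] {m : Measure Y} {g l : Y → ℂ}

/-- The Laplace-type integral `∫ g e^{-x l}`. -/
noncomputable def laplaceIntegral (m : Measure Y) (g l : Y → ℂ) (x : ℝ) : ℂ :=
  ∫ y, g y * Complex.exp (-(x : ℂ) * l y) ∂m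

theorem norm_exp_neg_mul (x : ℝ) (w : ℂ) : ‖Complex.exp (-(x : ℂ) * w)‖ = Real.exp (-x * w.re) := by
  rw [Complex.norm_exp]; simp

theorem norm_exp_neg_mul_le_one {x : ℝ} (hx : 0 ≤ x) {w : ℂ} (hw : 0 < w.re) :
    ‖Complex.exp (-(x : ℂ) * w)‖ ≤ 1 := by
  rw [norm_exp_neg_mul, Real.exp_le_one_iff]
  nlinarith

theorem aestronglyMeasurable_laplace (hg : AEStronglyMeasurable g m)
    (hl : AEStronglyMeasurable l m) (x : ℝ) :
    AEStronglyMeasurable (fun y => g y * Complex.exp (-(x : ℂ) * l y)) m :=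
  hg.mul (Complex.continuous_exp.comp_aestronglyMeasurable (hl.const_mul _))

theorem integrable_laplace (hg : Integrable g m) (hl : AEStronglyMeasurable l m)
    (hpos : ∀ᵐ y ∂m, 0 < (l y).re) {x : ℝ} (hx : 0 ≤ x) :
    Integrable (fun y => g y * Complex.exp (-(x : ℂ) * l y)) m := by
  refine hg.mono (aestronglyMeasurable_laplace hg.1 hl x) ?_
  filter_upwards [hpos] with y hy
  rw [norm_mul]
  exact mul_le_of_le_one_right (norm_nonneg _) (norm_exp_neg_mul_le_one hx hy)

theorem tendsto_laplaceIntegral_atTop (hg : Integrable g m) (hl : AEStronglyMeasurable l m)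
    (hpos : ∀ᵐ y ∂m, 0 < (l y).re) : Tendsto (laplaceIntegral m g l) atTop (𝓝 0) := by
  have h : Tendsto (laplaceIntegral m g l) atTop (𝓝 (∫ _, (0 : ℂ) ∂m)) := by
    refine tendsto_integral_filter_of_dominated_convergence (fun y => ‖g y‖)
      (Eventually.of_forall fun x => aestronglyMeasurable_laplace hg.1 hl x) ?_ hg.norm ?_
    · filter_upwards [eventually_ge_atTop 0] with x hx
      filter_upwards [hpos] with y hy
      rw [norm_mul]
      exact mul_le_of_le_one_right (norm_nonneg _) (norm_exp_neg_mul_le_one hx hy)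
    · filter_upwards [hpos] with y hy
      rw [tendsto_zero_iff_norm_tendsto_zero]
      simp_rw [norm_mul, norm_exp_neg_mul]
      have h1 : Tendsto (fun x : ℝ => Real.exp (-x * (l y).re)) atTop (𝓝 0) := by
        refine Real.tendsto_exp_atBot.comp ?_
        simp_rw [neg_mul]
        exact tendsto_neg_atTop_atBot.comp (tendsto_id.atTop_mul_const hy)
      simpa using h1.const_mul ‖g y‖
  simpa using h

theorem continuousOn_laplaceIntegral (hg : Integrable g m) (hl : AEStronglyMeasurable l m)
    (hpos : ∀ᵐ y ∂m, 0 < (l y).re) : ContinuousOn (laplaceIntegral m g l) (Ici 0) := by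
  refine continuousOn_of_dominated (bound := fun y => ‖g y‖)
    (fun x _ => aestronglyMeasurable_laplace hg.1 hl x) ?_ hg.norm ?_
  · intro x hx
    filter_upwards [hpos] with y hy
    rw [norm_mul]
    exact mul_le_of_le_one_right (norm_nonneg _) (norm_exp_neg_mul_le_one hx hy)
  · refine Eventually.of_forall fun y => Continuous.continuousOn ?_
    fun_prop

theorem hasDerivAt_laplaceIntegral (hg : Integrable g m) (hl : AEStronglyMeasurable l m)
    (hpos : ∀ᵐ y ∂m, 0 < (l y).re) (hgl : Integrable (fun y => g y * l y) m) {x : ℝ}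
    (hx : 0 < x) :
    HasDerivAt (laplaceIntegral m g l) (-laplaceIntegral m (fun y => g y * l y) l x) x := by
  have h := (hasDerivAt_integral_of_dominated_loc_of_deriv_le (μ := m)
    (F := fun (x : ℝ) y => g y * Complex.exp (-(x : ℂ) * l y))
    (F' := fun (x : ℝ) y => -(g y * l y * Complex.exp (-(x : ℂ) * l y)))
    (bound := fun y => ‖g y * l y‖) (x₀ := x) (s := Ioi 0) (Ioi_mem_nhds hx)
    (Eventually.of_forall fun x => aestronglyMeasurable_laplace hg.1 hl x)
    (integrable_laplace hg hl hpos hx.le) (aestronglyMeasurable_laplace hgl.1 hl x).neg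
    ?_ hgl.norm ?_).2
  · rw [integral_neg] at h
    exact h
  · filter_upwards [hpos] with y hy t ht
    rw [norm_neg, norm_mul]
    exact mul_le_of_le_one_right (norm_nonneg _) (norm_exp_neg_mul_le_one (le_of_lt ht) hy)
  · refine Eventually.of_forall fun y t _ => ?_
    have h1 : HasDerivAt (fun t : ℝ => -(t : ℂ) * l y) (-1 * l y) t :=
      (Complex.ofRealCLM.hasDerivAt.neg).mul_const (l y)
    convert! (h1.cexp).const_mul (g y) using 1
    ring

end Laplace

/-! ### The transforms as Laplace integrals. -/

section Transform

variable {μ : ContourMeasure} {φ ψ : ℂ → ℂ} {r r' : ℝ}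

/-- The density of the transform at the point `r`. -/
noncomputable def transformDensity (μ : ContourMeasure) (φ : ℂ → ℂ) (r : ℝ) (v : ℂ) : ℂ :=
  φ v * Complex.exp (-(r : ℂ) * v) * μ.phase v

theorem measurable_transformDensity (hφ : Measurable φ) :
    Measurable fun p : ℝ × ℂ => transformDensity μ φ p.1 p.2 := by
  have := μ.measurable_phase
  unfold transformDensity
  fun_prop

theorem norm_transformDensity (r : ℝ) (v : ℂ) :
    ‖transformDensity μ φ r v‖ = ‖φ v‖ * Real.exp (-r * v.re) := by
  rw [transformDensity, norm_mul, norm_mul, μ.norm_phase, mul_one, norm_exp_neg_mul]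

theorem ae_re_pos (hC : ∀ v ∈ μ.C, 0 < v.re) : ∀ᵐ v ∂μ.total, 0 < v.re := by
  have : ∀ᵐ v ∂μ.total, v ∈ μ.C := μ.total_compl
  exact this.mono hC

/-- Absorbing e^{-rv} into the density means that absolute convergence at r alone controls every
shift x ≥ 0. -/
theorem transform_add_eq (r x : ℝ) :
    transform μ φ (r + x) = laplaceIntegral μ.total (transformDensity μ φ r) id x := by
  unfold transform laplaceIntegral transformDensity
  congr 1
  funext v
  rw [mul_assoc, mul_assoc, mul_assoc, mul_comm (μ.phase v), ← mul_assoc (Complex.exp _),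
    id, ← Complex.exp_add]
  congr 3
  push_cast; ring

theorem measurable_transform (hφ : Measurable φ) : Measurable (transform μ φ) :=
  ((measurable_transformDensity hφ).stronglyMeasurable.integral_prod_right
    (ν := μ.total)).measurable

/-- Absolute convergence of the transform and of its derivative at `r`. -/
def TransformIntegrable (μ : ContourMeasure) (φ : ℂ → ℂ) (r : ℝ) : Prop :=
  Integrable (fun v : ℂ => (1 + ‖v‖) * ‖φ v‖ * Real.exp (-r * v.re)) μ.total

theorem TransformIntegrable.density (h : TransformIntegrable μ φ r) (hφ : Measurable φ) :
    Integrable (transformDensity μ φ r) μ.total := by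
  refine h.mono ((measurable_transformDensity hφ).comp measurable_prodMk_left).aestronglyMeasurable
    (Eventually.of_forall fun v => ?_)
  rw [norm_transformDensity, Real.norm_of_nonneg (by positivity), mul_assoc]
  exact le_mul_of_one_le_left (by positivity) (by simp)

theorem TransformIntegrable.density_mul (h : TransformIntegrable μ φ r) (hφ : Measurable φ) :
    Integrable (fun v => transformDensity μ φ r v * v) μ.total := by
  refine h.mono (((measurable_transformDensity hφ).comp measurable_prodMk_left).mul
    measurable_id).aestronglyMeasurable (Eventually.of_forall fun v => ?_)
  rw [norm_mul, norm_transformDensity, Real.norm_of_nonneg (by positivity), mul_comm, ← mul_assoc]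
  gcongr
  simp

theorem TransformIntegrable.hasDerivAt (h : TransformIntegrable μ φ r) (hφ : Measurable φ)
    (hC : ∀ v ∈ μ.C, 0 < v.re) {x : ℝ} (hx : 0 < x) :
    HasDerivAt (transform μ φ)
      (-laplaceIntegral μ.total (fun v => transformDensity μ φ r v * v) id x) (r + x) := by
  have h1 := hasDerivAt_laplaceIntegral (l := id) (h.density hφ) aestronglyMeasurable_id
    (ae_re_pos hC) (h.density_mul hφ) hx
  have h2 : laplaceIntegral μ.total (transformDensity μ φ r) id =
      fun x => transform μ φ (r + x) := funext fun x => (transform_add_eq r x).symm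
  rw [h2] at h1
  have h3 := HasDerivAt.comp_sub_const (r + x) r (f := fun x => transform μ φ (r + x))
    (by simpa using h1)
  simpa using h3

theorem TransformIntegrable.deriv_eq (h : TransformIntegrable μ φ r) (hφ : Measurable φ)
    (hC : ∀ v ∈ μ.C, 0 < v.re) {x : ℝ} (hx : 0 < x) :
    deriv (transform μ φ) (r + x) =
      -laplaceIntegral μ.total (fun v => transformDensity μ φ r v * v) id x :=
  (h.hasDerivAt hφ hC hx).deriv

theorem TransformIntegrable.hasDerivAt_shift (h : TransformIntegrable μ φ r) (hφ : Measurable φ)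
    (hC : ∀ v ∈ μ.C, 0 < v.re) {x : ℝ} (hx : 0 < x) :
    HasDerivAt (fun x => transform μ φ (r + x)) (deriv (transform μ φ) (r + x)) x :=
  ((h.hasDerivAt hφ hC hx).differentiableAt.hasDerivAt).comp_const_add r x

theorem TransformIntegrable.continuousOn_shift (h : TransformIntegrable μ φ r)
    (hφ : Measurable φ) (hC : ∀ v ∈ μ.C, 0 < v.re) :
    ContinuousOn (fun x => transform μ φ (r + x)) (Ici 0) := by
  simp_rw [transform_add_eq]
  exact continuousOn_laplaceIntegral (h.density hφ) aestronglyMeasurable_id (ae_re_pos hC)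

theorem TransformIntegrable.tendsto_shift (h : TransformIntegrable μ φ r)
    (hφ : Measurable φ) (hC : ∀ v ∈ μ.C, 0 < v.re) :
    Tendsto (fun x => transform μ φ (r + x)) atTop (𝓝 0) := by
  simp_rw [transform_add_eq]
  exact tendsto_laplaceIntegral_atTop (h.density hφ) aestronglyMeasurable_id (ae_re_pos hC)

end Transform

end PfaffianDet

namespace PfaffianDet

open Filter Topology

/-! ### The pair kernel as an integral over the half-line. -/

section PairKernel

variable {μ : ContourMeasure} {φ ψ : ℂ → ℂ} {r r' : ℝ}

/-- The density of the pair kernel. -/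
noncomputable def pairDensity (μ : ContourMeasure) (φ ψ : ℂ → ℂ) (r r' : ℝ) (p : ℂ × ℂ) : ℂ :=
  transformDensity μ φ r p.1 * transformDensity μ ψ r' p.2 * ((p.1 - p.2) / (p.1 + p.2))

/-- The kernel of the Pfaffian point of view,
`∫∫ φ(v) ψ(w) e^{-rv-r'w} (v - w) / (v + w) μ(dv) μ(dw)`. -/
noncomputable def pairKernel (μ : ContourMeasure) (φ ψ : ℂ → ℂ) (r r' : ℝ) : ℂ :=
  ∫ p, pairDensity μ φ ψ r r' p ∂(μ.total.prod μ.total)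

/-- Absolute convergence of the diagonal pair kernel at `r`. -/
def PairIntegrable (μ : ContourMeasure) (φ ψ : ℂ → ℂ) (r : ℝ) : Prop :=
  Integrable (fun p : ℂ × ℂ => ‖φ p.1‖ * ‖ψ p.2‖ * ‖(p.1 - p.2) / (p.1 + p.2)‖ *
    Real.exp (-r * (p.1.re + p.2.re))) (μ.total.prod μ.total)

theorem pairKernel_skew : pairKernel μ φ ψ r r' = -pairKernel μ ψ φ r' r := by
  unfold pairKernel
  rw [← integral_prod_swap, ← integral_neg]
  congr 1
  funext p
  simp only [pairDensity, Prod.fst_swap, Prod.snd_swap]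
  rw [← neg_sub p.2 p.1, neg_div, add_comm p.1]
  ring

theorem measurable_pairDensity (hφ : Measurable φ) (hψ : Measurable ψ) :
    Measurable (pairDensity μ φ ψ r r') := by
  have h1 := (measurable_transformDensity (μ := μ) hφ).comp (measurable_prodMk_left (x := r))
  have h2 := (measurable_transformDensity (μ := μ) hψ).comp (measurable_prodMk_left (x := r'))
  exact ((h1.comp measurable_fst).mul (h2.comp measurable_snd)).mul (by fun_prop)

theorem ae_re_pos_prod (hC : ∀ v ∈ μ.C, 0 < v.re) :
    ∀ᵐ p : ℂ × ℂ ∂(μ.total.prod μ.total), 0 < p.1.re ∧ 0 < p.2.re := by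
  filter_upwards [Measure.quasiMeasurePreserving_fst.ae (ae_re_pos hC),
    Measure.quasiMeasurePreserving_snd.ae (ae_re_pos hC)] with p h1 h2
  exact ⟨h1, h2⟩

theorem integrable_pairDensity (h : PairIntegrable μ φ ψ r) (h' : PairIntegrable μ φ ψ r')
    (hφ : Measurable φ) (hψ : Measurable ψ) (hC : ∀ v ∈ μ.C, 0 < v.re) :
    Integrable (pairDensity μ φ ψ r r') (μ.total.prod μ.total) := by
  -- As both real parts are positive, the mixed exponential is dominated by the diagonal one at the
  -- smaller of r and r'.
  have hmin : PairIntegrable μ φ ψ (min r r') := by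
    rcases min_choice r r' with h1 | h1 <;> rwa [h1]
  refine hmin.mono (measurable_pairDensity hφ hψ).aestronglyMeasurable ?_
  filter_upwards [ae_re_pos_prod hC] with p hp
  rw [pairDensity, norm_mul, norm_mul, norm_transformDensity, norm_transformDensity,
    Real.norm_of_nonneg (by positivity)]
  have h1 : Real.exp (-r * p.1.re) * Real.exp (-r' * p.2.re) ≤
      Real.exp (-(min r r') * (p.1.re + p.2.re)) := by
    rw [← Real.exp_add, Real.exp_le_exp]
    nlinarith [mul_le_mul_of_nonneg_right (min_le_left r r') hp.1.le,
      mul_le_mul_of_nonneg_right (min_le_right r r') hp.2.le]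
  calc _ = ‖φ p.1‖ * ‖ψ p.2‖ * ‖(p.1 - p.2) / (p.1 + p.2)‖ *
        (Real.exp (-r * p.1.re) * Real.exp (-r' * p.2.re)) := by ring
    _ ≤ _ := by gcongr

/-- The factor v + w cancels the denominator, nonzero almost everywhere on the half-plane. What
remains is (v - w) times a product density, so Fubini applies, and each factor v or w is minus a
derivative. -/
theorem laplaceIntegral_pair_numerator (hr : TransformIntegrable μ φ r)
    (hr' : TransformIntegrable μ ψ r') (hφ : Measurable φ) (hψ : Measurable ψ)
    (hC : ∀ v ∈ μ.C, 0 < v.re) :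
    Integrable (fun p => pairDensity μ φ ψ r r' p * (p.1 + p.2)) (μ.total.prod μ.total) ∧
    ∀ x : ℝ, 0 < x → laplaceIntegral (μ.total.prod μ.total)
      (fun p => pairDensity μ φ ψ r r' p * (p.1 + p.2)) (fun p => p.1 + p.2) x =
      transform μ φ (r + x) * deriv (transform μ ψ) (r' + x) -
        deriv (transform μ φ) (r + x) * transform μ ψ (r' + x) := by
  have h0 : ∀ᵐ p : ℂ × ℂ ∂(μ.total.prod μ.total), pairDensity μ φ ψ r r' p * (p.1 + p.2) =
      (transformDensity μ φ r p.1 * p.1) * transformDensity μ ψ r' p.2 -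
        transformDensity μ φ r p.1 * (transformDensity μ ψ r' p.2 * p.2) := by
    filter_upwards [ae_re_pos_prod hC] with p hp
    have : p.1 + p.2 ≠ 0 := fun h0 => by
      have := congrArg Complex.re h0
      simp only [Complex.add_re, Complex.zero_re] at this
      linarith [hp.1, hp.2]
    rw [pairDensity]
    field_simp
  refine ⟨(((hr.density_mul hφ).mul_prod (hr'.density hψ)).sub
    ((hr.density hφ).mul_prod (hr'.density_mul hψ))).congr (h0.mono fun p hp => hp.symm), ?_⟩
  intro x hx
  have hpos := ae_re_pos hC
  have i1 := integrable_laplace (l := id) (hr.density hφ) aestronglyMeasurable_id hpos hx.le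
  have i2 := integrable_laplace (l := id) (hr.density_mul hφ) aestronglyMeasurable_id hpos hx.le
  have i3 := integrable_laplace (l := id) (hr'.density hψ) aestronglyMeasurable_id hpos hx.le
  have i4 := integrable_laplace (l := id) (hr'.density_mul hψ) aestronglyMeasurable_id hpos hx.le
  rw [hr.deriv_eq hφ hC hx, hr'.deriv_eq hψ hC hx, transform_add_eq, transform_add_eq]
  have e1 : laplaceIntegral (μ.total.prod μ.total)
      (fun p => pairDensity μ φ ψ r r' p * (p.1 + p.2)) (fun p => p.1 + p.2) x =
      ∫ p : ℂ × ℂ, ((transformDensity μ φ r p.1 * p.1 * Complex.exp (-(x : ℂ) * id p.1)) *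
          (transformDensity μ ψ r' p.2 * Complex.exp (-(x : ℂ) * id p.2)) -
        (transformDensity μ φ r p.1 * Complex.exp (-(x : ℂ) * id p.1)) *
          (transformDensity μ ψ r' p.2 * p.2 * Complex.exp (-(x : ℂ) * id p.2)))
        ∂(μ.total.prod μ.total) := by
    refine integral_congr_ae (h0.mono fun p hp => ?_)
    simp only [hp, mul_add, Complex.exp_add, id]
    ring
  rw [e1, integral_sub (i2.mul_prod i3) (i1.mul_prod i4),
    integral_prod_mul (fun v => transformDensity μ φ r v * v * Complex.exp (-(x : ℂ) * id v))
      (fun w => transformDensity μ ψ r' w * Complex.exp (-(x : ℂ) * id w)),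
    integral_prod_mul (fun v => transformDensity μ φ r v * Complex.exp (-(x : ℂ) * id v))
      (fun w => transformDensity μ ψ r' w * w * Complex.exp (-(x : ℂ) * id w))]
  unfold laplaceIntegral
  ring

/-- The kernels `f(r + x)` and `f'(r + x)` are square-integrable in `x`. -/
def ShiftSquareIntegrable (μ : ContourMeasure) (φ : ℂ → ℂ) (r : ℝ) : Prop :=
  MemLp (fun x => transform μ φ (r + x)) 2 halfLine ∧
    MemLp (fun x => deriv (transform μ φ) (r + x)) 2 halfLine

theorem pairKernel_eq_integral (hr : TransformIntegrable μ φ r)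
    (hr' : TransformIntegrable μ ψ r') (hφ : Measurable φ) (hψ : Measurable ψ)
    (hC : ∀ v ∈ μ.C, 0 < v.re) (h : PairIntegrable μ φ ψ r) (h' : PairIntegrable μ φ ψ r')
    (hs : ShiftSquareIntegrable μ φ r) (hs' : ShiftSquareIntegrable μ ψ r') :
    pairKernel μ φ ψ r r' = ∫ x, (transform μ φ (r + x) * deriv (transform μ ψ) (r' + x) -
      deriv (transform μ φ) (r + x) * transform μ ψ (r' + x)) ∂halfLine ∧
    pairKernel μ φ ψ r r' + transform μ φ r * transform μ ψ r' =
      -2 * ∫ x, deriv (transform μ φ) (r + x) * transform μ ψ (r' + x) ∂halfLine := by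
  have hD := integrable_pairDensity h h' hφ hψ hC
  obtain ⟨hN, hN'⟩ := laplaceIntegral_pair_numerator hr hr' hφ hψ hC
  let l : ℂ × ℂ → ℂ := fun p => p.1 + p.2
  have hl : AEStronglyMeasurable l (μ.total.prod μ.total) :=
    (measurable_fst.add measurable_snd).aestronglyMeasurable
  have hpos : ∀ᵐ p ∂(μ.total.prod μ.total), 0 < (l p).re :=
    (ae_re_pos_prod hC).mono fun p hp => by simpa [l] using add_pos hp.1 hp.2
  let D := laplaceIntegral (μ.total.prod μ.total) (pairDensity μ φ ψ r r') l
  have hD0 : D 0 = pairKernel μ φ ψ r r' := by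
    simp [D, laplaceIntegral, pairKernel]
  have hDcont : ContinuousWithinAt D (Ici 0) 0 :=
    continuousOn_laplaceIntegral hD hl hpos 0 self_mem_Ici
  have hDtend : Tendsto D atTop (𝓝 0) := tendsto_laplaceIntegral_atTop hD hl hpos
  have hDderiv : ∀ x ∈ Ioi (0 : ℝ), HasDerivAt D
      (-(transform μ φ (r + x) * deriv (transform μ ψ) (r' + x) -
        deriv (transform μ φ) (r + x) * transform μ ψ (r' + x))) x := by
    intro x hx
    rw [← hN' x hx]
    exact hasDerivAt_laplaceIntegral hD hl hpos hN hx
  have i1 : IntegrableOn (fun x => transform μ φ (r + x) * deriv (transform μ ψ) (r' + x))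
      (Ioi 0) := hs.1.integrable_mul hs'.2
  have i2 : IntegrableOn (fun x => deriv (transform μ φ) (r + x) * transform μ ψ (r' + x))
      (Ioi 0) := hs.2.integrable_mul hs'.1
  constructor
  · have := integral_Ioi_of_hasDerivAt_of_tendsto hDcont hDderiv (i1.sub i2).neg hDtend
    rw [integral_neg, zero_sub, neg_inj, hD0] at this
    exact this.symm
  -- Adding the product f(r + x) g(r' + x) to D cancels f g' in the derivative and leaves 2 f' g.
  · have hc := hDcont.add ((hr.continuousOn_shift hφ hC 0 self_mem_Ici).mul
      (hr'.continuousOn_shift hψ hC 0 self_mem_Ici))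
    have ht := hDtend.add ((hr.tendsto_shift hφ hC).mul (hr'.tendsto_shift hψ hC))
    rw [mul_zero, add_zero] at ht
    have := integral_Ioi_of_hasDerivAt_of_tendsto hc
      (f' := fun x => 2 * (deriv (transform μ φ) (r + x) * transform μ ψ (r' + x)))
      (fun x hx => ((hDderiv x hx).add ((hr.hasDerivAt_shift hφ hC hx).mul
        (hr'.hasDerivAt_shift hψ hC hx))).congr_deriv (by ring)) (i2.const_mul 2) ht
    rw [integral_const_mul, zero_sub] at this
    simp only [Pi.add_apply, Pi.mul_apply, hD0, add_zero] at this
    rw [halfLine]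
    linear_combination this

end PairKernel

end PfaffianDet

namespace PfaffianDet

open Filter Topology

/-! ### The pair matrix: bounds and the complementary-minor identity. -/

section PairMatrix

theorem inner_toLp_eq_integral {X : Type*} [MeasurableSpace X] {m : Measure X} {f g : X → ℂ}
    (hf : MemLp f 2 m) (hg : MemLp g 2 m) :
    inner ℂ (hf.toLp f) (hg.toLp g) = ∫ x, g x * (starRingEnd ℂ) (f x) ∂m := by
  rw [L2.inner_def]
  refine integral_congr_ae ?_
  filter_upwards [hf.coeFn_toLp, hg.coeFn_toLp] with x h1 h2
  rw [h1, h2]; rfl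

theorem norm_sq_toLp_eq_integral {X : Type*} [MeasurableSpace X] {m : Measure X} {f : X → ℂ}
    (hf : MemLp f 2 m) : ‖hf.toLp f‖ ^ 2 = ∫ x, ‖f x‖ ^ 2 ∂m := by
  have h := inner_self_eq_norm_sq_to_K (𝕜 := ℂ) (hf.toLp f)
  rw [inner_toLp_eq_integral hf hf] at h
  simp_rw [Complex.mul_conj'] at h
  have h2 : ((∫ x, ‖f x‖ ^ 2 ∂m : ℝ) : ℂ) = ∫ x, ((‖f x‖ : ℂ)) ^ 2 ∂m := by
    rw [← integral_complex_ofReal]; push_cast; rfl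
  rw [← h2] at h
  apply Complex.ofReal_injective
  rw [Complex.ofReal_pow]
  exact h.symm

variable {P : Type} [Fintype P] [DecidableEq P] {μ : ContourMeasure} {φ : Fin 2 → ℂ → ℂ}

/-- All the integrals attached to the point `r` converge absolutely. -/
structure GoodPoint (μ : ContourMeasure) (φ : Fin 2 → ℂ → ℂ) (r : ℝ) : Prop where
  transform : ∀ a, TransformIntegrable μ (φ a) r
  pair : ∀ a b, PairIntegrable μ (φ a) (φ b) r
  square : ∀ a, ShiftSquareIntegrable μ (φ a) r

/-- The matrix of the pair kernel at the points `r`. -/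
noncomputable def pairMatrix (μ : ContourMeasure) (φ : Fin 2 → ℂ → ℂ) (r : P → ℝ) :
    Matrix (P × Fin 2) (P × Fin 2) ℂ :=
  Matrix.of fun i j => pairKernel μ (φ i.2) (φ j.2) (r i.1) (r j.1)

omit [Fintype P] [DecidableEq P] in
theorem pairMatrix_skew (r : P → ℝ) (i j : P × Fin 2) :
    pairMatrix μ φ r i j = -pairMatrix μ φ r j i :=
  pairKernel_skew

/-- The squared Sobolev-type norm of `f(r + ·)`. -/
noncomputable def shiftEnergy (μ : ContourMeasure) (φ : ℂ → ℂ) (r : ℝ) : ℝ :=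
  ∫ x, ‖transform μ φ (r + x)‖ ^ 2 ∂halfLine + ∫ x, ‖deriv (transform μ φ) (r + x)‖ ^ 2 ∂halfLine

theorem shiftEnergy_nonneg (φ : ℂ → ℂ) (r : ℝ) : 0 ≤ shiftEnergy μ φ r :=
  add_nonneg (integral_nonneg fun _ => sq_nonneg _) (integral_nonneg fun _ => sq_nonneg _)

theorem norm_det_pairMatrix_le (hφ : ∀ a, Measurable (φ a)) (hC : ∀ v ∈ μ.C, 0 < v.re)
    {r : P → ℝ} (hr : ∀ p, GoodPoint μ φ (r p)) :
    ‖(pairMatrix μ φ r).det‖ ≤ ∏ i : P × Fin 2, shiftEnergy μ (φ i.2) (r i.1) := by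
  let H := WithLp 2 (Lp ℂ 2 halfLine × Lp ℂ 2 halfLine)
  have hf : ∀ i : P × Fin 2, MemLp (fun x => transform μ (φ i.2) (r i.1 + x)) 2 halfLine :=
    fun i => ((hr i.1).square i.2).1
  have hf' : ∀ i : P × Fin 2, MemLp (fun x => deriv (transform μ (φ i.2)) (r i.1 + x)) 2 halfLine :=
    fun i => ((hr i.1).square i.2).2
  -- With a = (conj f, -conj f') and b = (f', f), the inner product is the integral of f_i f_j' -
  -- f_i' f_j, and both vectors have squared norm `shiftEnergy`.
  let a : P × Fin 2 → H := fun i =>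
    WithLp.toLp 2 ((hf i).star.toLp _, (hf' i).neg.star.toLp _)
  let b : P × Fin 2 → H := fun i => WithLp.toLp 2 ((hf' i).toLp _, (hf i).toLp _)
  have hint : ∀ i j : P × Fin 2, Integrable (fun x => transform μ (φ i.2) (r i.1 + x) *
      deriv (transform μ (φ j.2)) (r j.1 + x)) halfLine := fun i j =>
    (hf i).integrable_mul (hf' j)
  have hint' : ∀ i j : P × Fin 2, Integrable (fun x => deriv (transform μ (φ i.2)) (r i.1 + x) *
      transform μ (φ j.2) (r j.1 + x)) halfLine := fun i j =>
    (hf' i).integrable_mul (hf j)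
  have hmat : pairMatrix μ φ r = Matrix.of fun i j => inner ℂ (a i) (b j) := by
    ext i j
    rw [Matrix.of_apply, WithLp.prod_inner_apply]
    simp only [a, b]
    rw [inner_toLp_eq_integral, inner_toLp_eq_integral, pairMatrix, Matrix.of_apply,
      (pairKernel_eq_integral ((hr i.1).transform i.2) ((hr j.1).transform j.2) (hφ _) (hφ _) hC
        ((hr i.1).pair _ _) ((hr j.1).pair _ _) ((hr i.1).square _) ((hr j.1).square _)).1,
      integral_sub (hint i j) (hint' i j), sub_eq_add_neg,
      ← integral_neg]
    congr 1
    · congr 1; funext x; simp [mul_comm]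
    · congr 1; funext x; simp [mul_comm]
  have ha : ∀ i, ‖a i‖ = Real.sqrt (shiftEnergy μ (φ i.2) (r i.1)) := by
    intro i
    rw [WithLp.prod_norm_eq_of_L2]
    show Real.sqrt (‖(hf i).star.toLp _‖ ^ 2 + ‖(hf' i).neg.star.toLp _‖ ^ 2) = _
    rw [norm_sq_toLp_eq_integral, norm_sq_toLp_eq_integral]
    simp [shiftEnergy]
  have hb : ∀ i, ‖b i‖ = Real.sqrt (shiftEnergy μ (φ i.2) (r i.1)) := by
    intro i
    rw [WithLp.prod_norm_eq_of_L2]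
    show Real.sqrt (‖(hf' i).toLp _‖ ^ 2 + ‖(hf i).toLp _‖ ^ 2) = _
    rw [norm_sq_toLp_eq_integral, norm_sq_toLp_eq_integral, add_comm]
    rfl
  rw [hmat]
  refine (norm_det_inner_le a b).trans_eq ?_
  rw [← Finset.prod_mul_distrib]
  refine Finset.prod_congr rfl fun i _ => ?_
  rw [ha, hb, Real.mul_self_sqrt (shiftEnergy_nonneg _ _)]

/-- The total energy of the two transforms. -/
noncomputable def totalEnergy (μ : ContourMeasure) (φ : Fin 2 → ℂ → ℂ) (r : ℝ) : ℝ :=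
  ∑ a, shiftEnergy μ (φ a) r

theorem totalEnergy_nonneg (φ : Fin 2 → ℂ → ℂ) (r : ℝ) : 0 ≤ totalEnergy μ φ r :=
  Finset.sum_nonneg fun _ _ => shiftEnergy_nonneg _ _

theorem norm_blockPf_pairMatrix_le (hφ : ∀ a, Measurable (φ a)) (hC : ∀ v ∈ μ.C, 0 < v.re)
    {r : P → ℝ} (hr : ∀ p, GoodPoint μ φ (r p)) :
    ‖blockPf (pairMatrix μ φ r)‖ ≤ ∏ p, totalEnergy μ φ (r p) := by
  refine le_of_sq_le_sq ?_ (Finset.prod_nonneg fun p _ => totalEnergy_nonneg _ _)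
  rw [← norm_pow, blockPf_sq _ (pairMatrix_skew r)]
  refine (norm_det_pairMatrix_le hφ hC hr).trans ?_
  rw [Fintype.prod_prod_type, ← Finset.prod_pow]
  refine Finset.prod_le_prod (fun p _ => Finset.prod_nonneg fun a _ => shiftEnergy_nonneg _ _)
    fun p _ => ?_
  rw [Fin.prod_univ_two, totalEnergy, Fin.sum_univ_two]
  have h0 := shiftEnergy_nonneg (μ := μ) (φ 0) (r p)
  have h1 := shiftEnergy_nonneg (μ := μ) (φ 1) (r p)
  nlinarith

/-- The left factor of the scalar kernel. -/
noncomputable def leftFactor (f : Fin 2 → ℝ → ℂ) (a : Fin 2) (t : ℝ) : ℂ :=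
  if a = 0 then 2 * deriv (f 1) t else -2 * deriv (f 0) t

/-- The rank-one vector is taken to be u = f(r), precisely the boundary term that turns the entries
of K into -2 ∫ f' g. The symplectic row operation produces the signs in `leftFactor`. -/
theorem sum_blockPf_pairMatrix (hφ : ∀ a, Measurable (φ a)) (hC : ∀ v ∈ μ.C, 0 < v.re)
    {r : P → ℝ} (hr : ∀ p, GoodPoint μ φ (r p)) :
    ∑ V : Finset P, blockPf (pairMatrix μ φ fun p : V => r p) *
        blockPf (pairMatrix μ φ fun p : (Vᶜ : Finset P) => r p) =
      ∑ s : P → Fin 2, (Matrix.of fun p q =>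
        ∫ x, leftFactor (fun a => transform μ (φ a)) (s p) (r p + x) *
          transform μ (φ (s q)) (r q + x) ∂halfLine).det := by
  refine (sum_blockPf_mul_blockPf_compl (pairMatrix_skew r)
    (fun i => transform μ (φ i.2) (r i.1))).trans ?_
  refine Finset.sum_congr rfl fun s _ => ?_
  congr 2
  funext p q
  let N : Matrix (P × Fin 2) (P × Fin 2) ℂ := pairMatrix μ φ r + Matrix.vecMulVec
    (fun i : P × Fin 2 => transform μ (φ i.2) (r i.1)) (fun i => transform μ (φ i.2) (r i.1))
  have hN : ∀ i j : P × Fin 2, N i j =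
      -2 * ∫ x, deriv (transform μ (φ i.2)) (r i.1 + x) * transform μ (φ j.2) (r j.1 + x)
        ∂halfLine := by
    intro i j
    exact (pairKernel_eq_integral ((hr i.1).transform i.2) ((hr j.1).transform j.2) (hφ _) (hφ _)
      hC ((hr i.1).pair _ _) ((hr j.1).pair _ _) ((hr i.1).square _) ((hr j.1).square _)).2
  show (if s p = 0 then -N (p, 1) (q, s q) else N (p, 0) (q, s q)) = _
  simp only [hN, leftFactor]
  split_ifs with h
  · rw [← integral_const_mul, ← integral_neg]
    congr 1; funext x; ring
  · rw [← integral_const_mul]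
    congr 1; funext x; ring

end PairMatrix

end PfaffianDet

namespace PfaffianDet

open Filter Topology

/-! ### The inner integral as a Pfaffian of integrals. -/

section Moments

variable {P : Type} [Fintype P]

/-- Two copies of the blocks, as the set of all indices. -/
def sumIndexEquiv : P ⊕ P ≃ P × Fin 2 where
  toFun := Sum.elim (fun p => (p, 0)) (fun p => (p, 1))
  invFun i := if i.2 = 0 then Sum.inl i.1 else Sum.inr i.1
  left_inv i := by rcases i with i | i <;> simp
  right_inv i := by
    obtain ⟨p, a⟩ := i
    fin_cases a <;> simp

theorem measurePreserving_pairs {Y : Type*} [MeasurableSpace Y] (m : Measure Y) [SigmaFinite m]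
    (σ : Equiv.Perm (P × Fin 2)) :
    MeasurePreserving (fun (X : P × Fin 2 → Y) (p : P) => (X (σ (p, 0)), X (σ (p, 1))))
      (Measure.pi fun _ => m) (Measure.pi fun _ => m.prod m) := by
  have h1 := measurePreserving_comp_equiv m (sumIndexEquiv.trans σ : P ⊕ P ≃ P × Fin 2)
  have h2 := measurePreserving_sumPiEquivProdPi (X := fun _ : P ⊕ P => Y) (fun _ => m)
  have h3 := (measurePreserving_arrowProdEquivProdArrow Y Y P (fun _ => m) (fun _ => m)).symm
  exact h3.comp (h2.comp h1)

variable {μ : ContourMeasure} {φ : Fin 2 → ℂ → ℂ} {n : ℕ}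

/-- The weights form a product over all 2n indices, so they can be regrouped along the pairing of
any σ and absorbed into that term of the Pfaffian. -/
theorem momentIntegrand_eq (r : Fin n → ℝ) (X : Fin n × Fin 2 → ℂ) :
    momentIntegrand μ (φ 0) (φ 1) r X = ((2 : ℂ) ^ n * (n.factorial : ℂ))⁻¹ *
      ∑ σ : Equiv.Perm (Fin n × Fin 2), ((Equiv.Perm.sign σ : ℤ) : ℂ) *
        ∏ p, pairDensity μ (φ (σ (p, 0)).2) (φ (σ (p, 1)).2) (r (σ (p, 0)).1) (r (σ (p, 1)).1)
          (X (σ (p, 0)), X (σ (p, 1))) := by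
  have h1 : (∏ p : Fin n, φ 0 (X (p, 0)) * φ 1 (X (p, 1)) *
      Complex.exp (-(r p : ℂ) * (X (p, 0) + X (p, 1)))) * ∏ i, μ.phase (X i) =
      ∏ i : Fin n × Fin 2, transformDensity μ (φ i.2) (r i.1) (X i) := by
    simp only [Fintype.prod_prod_type, Fin.prod_univ_two]
    rw [← Finset.prod_mul_distrib]
    refine Finset.prod_congr rfl fun p _ => ?_
    simp only [transformDensity, mul_add, Complex.exp_add]
    ring
  have h2 : ∀ σ : Equiv.Perm (Fin n × Fin 2),
      ∏ p, pairDensity μ (φ (σ (p, 0)).2) (φ (σ (p, 1)).2) (r (σ (p, 0)).1) (r (σ (p, 1)).1)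
          (X (σ (p, 0)), X (σ (p, 1))) =
      (∏ i : Fin n × Fin 2, transformDensity μ (φ i.2) (r i.1) (X i)) *
        ∏ p, schurMatrix X (σ (p, 0)) (σ (p, 1)) := by
    intro σ
    rw [← Equiv.prod_comp σ (fun i => transformDensity μ (φ i.2) (r i.1) (X i)), Fintype.prod_prod_type,
      ← Finset.prod_mul_distrib]
    refine Finset.prod_congr rfl fun p _ => ?_
    rw [Fin.prod_univ_two]
    rfl
  simp_rw [h2]
  rw [momentIntegrand, mul_right_comm, h1, pfaffian, Finset.mul_sum, Finset.mul_sum,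
    Finset.mul_sum]
  refine Finset.sum_congr rfl fun σ _ => ?_
  ring

theorem integrable_prod_pairDensity (hφ : ∀ a, Measurable (φ a)) (hC : ∀ v ∈ μ.C, 0 < v.re)
    {r : Fin n → ℝ} (hr : ∀ p, GoodPoint μ φ (r p)) (σ : Equiv.Perm (Fin n × Fin 2)) :
    Integrable (fun X : Fin n → ℂ × ℂ => ∏ p, pairDensity μ (φ (σ (p, 0)).2) (φ (σ (p, 1)).2)
      (r (σ (p, 0)).1) (r (σ (p, 1)).1) (X p)) (Measure.pi fun _ => μ.total.prod μ.total) :=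
  Integrable.fintype_prod (f := fun p => pairDensity μ (φ (σ (p, 0)).2) (φ (σ (p, 1)).2)
      (r (σ (p, 0)).1) (r (σ (p, 1)).1)) fun _ =>
    integrable_pairDensity ((hr _).pair _ _) ((hr _).pair _ _) (hφ _) (hφ _) hC

theorem integrable_prod_pairDensity_comp (hφ : ∀ a, Measurable (φ a)) (hC : ∀ v ∈ μ.C, 0 < v.re)
    {r : Fin n → ℝ} (hr : ∀ p, GoodPoint μ φ (r p)) (σ : Equiv.Perm (Fin n × Fin 2)) :
    Integrable (fun X : Fin n × Fin 2 → ℂ => ∏ p, pairDensity μ (φ (σ (p, 0)).2) (φ (σ (p, 1)).2)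
      (r (σ (p, 0)).1) (r (σ (p, 1)).1) (X (σ (p, 0)), X (σ (p, 1))))
      (Measure.pi fun _ => μ.total) :=
  (measurePreserving_pairs μ.total σ).integrable_comp_of_integrable
    (integrable_prod_pairDensity hφ hC hr σ)

theorem integrable_momentIntegrand (hφ : ∀ a, Measurable (φ a)) (hC : ∀ v ∈ μ.C, 0 < v.re)
    {r : Fin n → ℝ} (hr : ∀ p, GoodPoint μ φ (r p)) :
    Integrable (momentIntegrand μ (φ 0) (φ 1) r) (Measure.pi fun _ => μ.total) := by
  refine Integrable.congr ?_ (Eventually.of_forall fun X => (momentIntegrand_eq r X).symm)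
  exact (integrable_finsetSum _ fun σ _ =>
    (integrable_prod_pairDensity_comp hφ hC hr σ).const_mul _).const_mul _

theorem momentInner_eq_blockPf (hφ : ∀ a, Measurable (φ a)) (hC : ∀ v ∈ μ.C, 0 < v.re)
    {r : Fin n → ℝ} (hr : ∀ p, GoodPoint μ φ (r p)) :
    momentInner μ (φ 0) (φ 1) r = blockPf (pairMatrix μ φ r) := by
  have hint := fun σ => integrable_prod_pairDensity hφ hC hr σ
  have hmp := fun σ => measurePreserving_pairs (P := Fin n) μ.total σ
  rw [momentInner, integral_congr_ae (Eventually.of_forall fun X => momentIntegrand_eq r X),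
    integral_const_mul, integral_finsetSum _ fun σ _ =>
      (integrable_prod_pairDensity_comp hφ hC hr σ).const_mul _, blockPf, Fintype.card_fin]
  congr 1
  refine Finset.sum_congr rfl fun σ _ => ?_
  rw [integral_const_mul, pfTerm]
  congr 1
  have h1 := integral_map (hmp σ).measurable.aemeasurable
    (by rw [(hmp σ).map_eq]; exact (hint σ).aestronglyMeasurable)
  rw [(hmp σ).map_eq] at h1
  refine h1.symm.trans ?_
  exact integral_fintype_prod_eq_prod (fun p => pairDensity μ (φ (σ (p, 0)).2) (φ (σ (p, 1)).2)
      (r (σ (p, 0)).1) (r (σ (p, 1)).1))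

theorem stronglyMeasurable_momentInner (hφ : ∀ a, Measurable (φ a)) :
    StronglyMeasurable fun r : Fin n → ℝ => momentInner μ (φ 0) (φ 1) r := by
  unfold momentInner
  have h0 := hφ 0
  have h1 := hφ 1
  have h2 := μ.measurable_phase
  have h : Measurable fun q : (Fin n → ℝ) × (Fin n × Fin 2 → ℂ) =>
      momentIntegrand μ (φ 0) (φ 1) q.1 q.2 := by
    unfold momentIntegrand pfaffian schurMatrix
    simp only [Matrix.of_apply]
    fun_prop
  exact h.stronglyMeasurable.integral_prod_right

end Moments

end PfaffianDet

namespace PfaffianDet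

open Filter Topology

/-! ### Integration over r and bounds on the moments. -/

section IntegratedMoments

variable {μ : ContourMeasure} {φ : Fin 2 → ℂ → ℂ} {ν : Measure ℝ}

theorem integrable_shiftEnergy {φ : ℂ → ℂ} (h : ShiftHilbertSchmidt ν (transform μ φ))
    (h' : ShiftHilbertSchmidt ν (deriv (transform μ φ))) : Integrable (shiftEnergy μ φ) ν :=
  (((memLp_two_iff_integrable_sq_norm h.1).1 h).integral_prod_left).add
    (((memLp_two_iff_integrable_sq_norm h'.1).1 h').integral_prod_left)

/-- The hypotheses on the kernels, for the pair of functions `φ`. -/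
structure Admissible (μ : ContourMeasure) (φ : Fin 2 → ℂ → ℂ) (ν : Measure ℝ) : Prop where
  re_pos : ∀ v ∈ μ.C, 0 < v.re
  measurable : ∀ a, Measurable (φ a)
  good : ∀ᵐ r ∂ν, GoodPoint μ φ r
  hilbertSchmidt : ∀ a, ShiftHilbertSchmidt ν (transform μ (φ a))
  hilbertSchmidt_deriv : ∀ a, ShiftHilbertSchmidt ν (deriv (transform μ (φ a)))

variable (H : Admissible μ φ ν)

include H

theorem Admissible.integrable_totalEnergy : Integrable (totalEnergy μ φ) ν :=
  integrable_finsetSum _ fun a _ =>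
    integrable_shiftEnergy (H.hilbertSchmidt a) (H.hilbertSchmidt_deriv a)

variable [SigmaFinite ν]

theorem Admissible.ae_good {P : Type} [Fintype P] :
    ∀ᵐ r : P → ℝ ∂(Measure.pi fun _ => ν), ∀ p, GoodPoint μ φ (r p) :=
  ae_pi_forall fun _ => H.good

theorem Admissible.momentInner_ae_eq (n : ℕ) :
    (fun r : Fin n → ℝ => momentInner μ (φ 0) (φ 1) r) =ᵐ[Measure.pi fun _ => ν]
      fun r => blockPf (pairMatrix μ φ r) :=
  H.ae_good.mono fun _ hr => momentInner_eq_blockPf H.measurable H.re_pos hr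

theorem Admissible.norm_momentInner_le (n : ℕ) :
    ∀ᵐ r : Fin n → ℝ ∂(Measure.pi fun _ => ν),
      ‖momentInner μ (φ 0) (φ 1) r‖ ≤ ∏ p, totalEnergy μ φ (r p) := by
  filter_upwards [H.ae_good (P := Fin n)] with r hr
  rw [momentInner_eq_blockPf H.measurable H.re_pos hr]
  exact norm_blockPf_pairMatrix_le H.measurable H.re_pos hr

theorem Admissible.integrable_momentInner (n : ℕ) :
    Integrable (fun r : Fin n → ℝ => momentInner μ (φ 0) (φ 1) r) (Measure.pi fun _ => ν) :=
  (Integrable.fintype_prod (f := fun _ : Fin n => totalEnergy μ φ)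
    fun _ => H.integrable_totalEnergy).mono'
    (stronglyMeasurable_momentInner H.measurable).aestronglyMeasurable (H.norm_momentInner_le n)

/-- This geometric growth is what yields absolute convergence for every τ. -/
theorem Admissible.norm_Z_le (n : ℕ) :
    ‖Z μ ν (φ 0) (φ 1) n‖ ≤ (∫ r, totalEnergy μ φ r ∂ν) ^ n := by
  refine (norm_integral_le_of_norm_le (Integrable.fintype_prod
    (f := fun _ : Fin n => totalEnergy μ φ) fun _ => H.integrable_totalEnergy)
    (H.norm_momentInner_le n)).trans_eq ?_
  simpa using integral_fintype_prod_eq_pow (ι := Fin n) (μ := ν) (totalEnergy μ φ)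

theorem Admissible.integral_blockPf (P : Type) [Fintype P] [DecidableEq P] :
    Integrable (fun r : P → ℝ => blockPf (pairMatrix μ φ r)) (Measure.pi fun _ => ν) ∧
    ∫ r : P → ℝ, blockPf (pairMatrix μ φ r) ∂(Measure.pi fun _ => ν) =
      Z μ ν (φ 0) (φ 1) (Fintype.card P) := by
  let e := (Fintype.equivFin P).symm
  have hmp := measurePreserving_comp_equiv ν e
  have h1 : Integrable (fun r : Fin (Fintype.card P) → ℝ => blockPf (pairMatrix μ φ r))
      (Measure.pi fun _ => ν) := (H.integrable_momentInner _).congr (H.momentInner_ae_eq _)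
  have h2 : ∀ r : P → ℝ, blockPf (pairMatrix μ φ (r ∘ e)) = blockPf (pairMatrix μ φ r) :=
    fun r => blockPf_reindex e (pairMatrix μ φ r)
  constructor
  · have := hmp.integrable_comp_of_integrable h1
    exact this.congr (Eventually.of_forall h2)
  · have h3 := integral_map hmp.measurable.aemeasurable
      (by rw [hmp.map_eq]; exact h1.aestronglyMeasurable)
    rw [hmp.map_eq] at h3
    rw [Z, integral_congr_ae (H.momentInner_ae_eq _), h3]
    exact integral_congr_ae (Eventually.of_forall fun r => (h2 r).symm)

/-- The two Pfaffians depend on disjoint sets of coordinates of r, so Fubini separates them. -/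
theorem Admissible.integral_blockPf_mul_compl {P : Type} [Fintype P] [DecidableEq P]
    (V : Finset P) :
    Integrable (fun r : P → ℝ => blockPf (pairMatrix μ φ fun p : V => r p) *
        blockPf (pairMatrix μ φ fun p : (Vᶜ : Finset P) => r p)) (Measure.pi fun _ => ν) ∧
    ∫ r : P → ℝ, blockPf (pairMatrix μ φ fun p : V => r p) *
        blockPf (pairMatrix μ φ fun p : (Vᶜ : Finset P) => r p) ∂(Measure.pi fun _ => ν) =
      Z μ ν (φ 0) (φ 1) V.card * Z μ ν (φ 0) (φ 1) Vᶜ.card := by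
  have hmp : MeasurePreserving (MeasurableEquiv.piEquivPiSubtypeProd (fun _ => ℝ) (fun p => p ∈ V))
      (Measure.pi fun _ : P => ν)
      ((Measure.pi fun _ : V => ν).prod (Measure.pi fun _ : {p // ¬ p ∈ V} => ν)) := by
    convert! measurePreserving_piEquivPiSubtypeProd (fun _ : P => ν) (fun p => p ∈ V)
  let e : {p // ¬ p ∈ V} ≃ (Vᶜ : Finset P) :=
    Equiv.subtypeEquivRight fun p => Finset.mem_compl.symm
  have hV := H.integral_blockPf V
  have hVc := H.integral_blockPf {p // ¬ p ∈ V}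
  have hcard : Fintype.card {p // ¬ p ∈ V} = Vᶜ.card := by
    rw [Fintype.card_congr e, Fintype.card_coe]
  rw [Fintype.card_coe] at hV
  rw [hcard] at hVc
  have h1 := hV.1.mul_prod hVc.1
  have h2 : ∀ r : P → ℝ, blockPf (pairMatrix μ φ fun p : {p // ¬ p ∈ V} => r p) =
      blockPf (pairMatrix μ φ fun p : (Vᶜ : Finset P) => r p) :=
    fun r => blockPf_reindex e (pairMatrix μ φ fun p : (Vᶜ : Finset P) => r p)
  simp_rw [← h2]
  constructor
  · exact hmp.integrable_comp_of_integrable h1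
  · rw [← hV.2, ← hVc.2, ← integral_prod_mul]
    exact hmp.integral_comp' (fun q : (V → ℝ) × ({p // ¬ p ∈ V} → ℝ) =>
      blockPf (pairMatrix μ φ q.1) * blockPf (pairMatrix μ φ q.2))

end IntegratedMoments

end PfaffianDet

namespace PfaffianDet

open Filter Topology

/-! ### The scalar kernel and its minors. -/

section ScalarKernel

variable {μ : ContourMeasure} {ν : Measure ℝ}

/-- One-dimensional Sobolev bound: f² at y is minus the integral of 2 f f' beyond y. It gives square
integrability in r at every y ≥ 0, whereas f' is controlled only for almost every x. -/
theorem norm_sq_transform_le_shiftEnergy {φ : ℂ → ℂ} {r : ℝ} (hr : TransformIntegrable μ φ r)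
    (hs : ShiftSquareIntegrable μ φ r) (hφ : Measurable φ) (hC : ∀ v ∈ μ.C, 0 < v.re) {y : ℝ}
    (hy : 0 ≤ y) : ‖transform μ φ (r + y)‖ ^ 2 ≤ shiftEnergy μ φ r := by
  have hsub : Ioi y ⊆ Ioi (0 : ℝ) := Ioi_subset_Ioi hy
  have i1 : IntegrableOn (fun x => transform μ φ (r + x) * deriv (transform μ φ) (r + x))
      (Ioi 0) := hs.1.integrable_mul hs.2
  have i2 : Integrable (fun x => ‖transform μ φ (r + x)‖ ^ 2) halfLine :=
    (memLp_two_iff_integrable_sq_norm hs.1.1).1 hs.1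
  have i3 : Integrable (fun x => ‖deriv (transform μ φ) (r + x)‖ ^ 2) halfLine :=
    (memLp_two_iff_integrable_sq_norm hs.2.1).1 hs.2
  have hc : ContinuousWithinAt (fun x => transform μ φ (r + x) ^ 2) (Ici y) y :=
    (((hr.continuousOn_shift hφ hC) y hy).mono (Ici_subset_Ici.2 hy)).pow 2
  have ht := (hr.tendsto_shift hφ hC).pow 2
  have h := integral_Ioi_of_hasDerivAt_of_tendsto hc
    (f' := fun x => 2 * (transform μ φ (r + x) * deriv (transform μ φ) (r + x)))
    (fun x hx => ((hr.hasDerivAt_shift hφ hC (hsub hx)).pow 2).congr_deriv (by simp; ring))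
    ((i1.mono_set hsub).const_mul 2) ht
  simp only [ne_eq, OfNat.ofNat_ne_zero, not_false_eq_true, zero_pow, zero_sub] at h
  have h2 : ‖transform μ φ (r + y)‖ ^ 2 = ‖∫ x in Ioi y, 2 * (transform μ φ (r + x) *
      deriv (transform μ φ) (r + x))‖ := by rw [h, norm_neg, norm_pow]
  have i23 : IntegrableOn (fun x => ‖transform μ φ (r + x)‖ ^ 2 +
      ‖deriv (transform μ φ) (r + x)‖ ^ 2) (Ioi 0) := i2.add i3
  rw [h2, shiftEnergy, ← integral_add i2 i3]
  calc _ ≤ ∫ x in Ioi y, (‖transform μ φ (r + x)‖ ^ 2 + ‖deriv (transform μ φ) (r + x)‖ ^ 2) := by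
        refine norm_integral_le_of_norm_le (i23.mono_set hsub) (Eventually.of_forall fun x => ?_)
        rw [norm_mul, norm_mul]
        simp only [Complex.norm_ofNat]
        nlinarith [sq_nonneg (‖transform μ φ (r + x)‖ - ‖deriv (transform μ φ) (r + x)‖)]
    _ ≤ _ := setIntegral_mono_set i23
        (Eventually.of_forall fun x => add_nonneg (sq_nonneg _) (sq_nonneg _)) hsub.eventuallyLE

variable {φ : Fin 2 → ℂ → ℂ} (H : Admissible μ φ ν)

include H

theorem Admissible.memLp_transform_shift (a : Fin 2) {y : ℝ} (hy : 0 ≤ y) :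
    MemLp (fun r => transform μ (φ a) (r + y)) 2 ν := by
  have hm : AEStronglyMeasurable (fun r => transform μ (φ a) (r + y)) ν :=
    ((measurable_transform (H.measurable a)).comp (measurable_add_const y)).aestronglyMeasurable
  rw [memLp_two_iff_integrable_sq_norm hm]
  refine (integrable_shiftEnergy (H.hilbertSchmidt a) (H.hilbertSchmidt_deriv a)).mono'
    (hm.norm.pow 2) ?_
  filter_upwards [H.good] with r hr
  rw [Real.norm_of_nonneg (sq_nonneg _)]
  exact norm_sq_transform_le_shiftEnergy (hr.transform a) (hr.square a) (H.measurable a) H.re_pos hy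

theorem Admissible.memLp_leftFactor (a : Fin 2) :
    MemLp (fun p : ℝ × ℝ => leftFactor (fun a => transform μ (φ a)) a (p.1 + p.2)) 2
      (ν.prod halfLine) := by
  unfold leftFactor
  split_ifs
  · exact MemLp.const_mul (H.hilbertSchmidt_deriv 1) 2
  · exact MemLp.const_mul (H.hilbertSchmidt_deriv 0) (-2)

variable [SigmaFinite ν]

theorem Admissible.integrable_leftFactor_mul :
    ∀ᵐ x ∂halfLine, ∀ y : ℝ, 0 ≤ y → ∀ a, Integrable (fun r =>
      leftFactor (fun a => transform μ (φ a)) a (r + x) * transform μ (φ a) (r + y)) ν := by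
  have h : ∀ᵐ x ∂halfLine, ∀ a, MemLp (fun r =>
      leftFactor (fun a => transform μ (φ a)) a (r + x)) 2 ν :=
    ae_all_iff.2 fun a => memLp_two_section_swap (H.memLp_leftFactor a)
  filter_upwards [h] with x hx y hy a
  exact (hx a).integrable_mul (H.memLp_transform_shift a hy)

omit H [SigmaFinite ν] in
theorem kernelIntegrand_eq (f : Fin 2 → ℝ → ℂ) (x y r : ℝ) :
    kernelIntegrand (f 0) (f 1) x y r =
      2⁻¹ * ∑ a, leftFactor f a (r + x) * f a (r + y) := by
  simp [kernelIntegrand, leftFactor, Fin.sum_univ_two]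
  ring

theorem Admissible.integrable_kernelIntegrand :
    ∀ᵐ x ∂halfLine, ∀ y : ℝ, 0 ≤ y → Integrable
      (kernelIntegrand (transform μ (φ 0)) (transform μ (φ 1)) x y) ν := by
  filter_upwards [H.integrable_leftFactor_mul] with x hx y hy
  rw [funext fun r => kernelIntegrand_eq (fun a => transform μ (φ a)) x y r]
  exact (integrable_finsetSum _ fun a _ => hx y hy a).const_mul _

theorem Admissible.scalarKernel_eq :
    ∀ᵐ x ∂halfLine, ∀ y : ℝ, 0 ≤ y →
      scalarKernel ν (transform μ (φ 0)) (transform μ (φ 1)) x y = ∑ a, ∫ r,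
        leftFactor (fun a => transform μ (φ a)) a (r + x) * transform μ (φ a) (r + y) ∂ν := by
  filter_upwards [H.integrable_leftFactor_mul] with x hx y hy
  rw [scalarKernel, funext fun r => kernelIntegrand_eq (fun a => transform μ (φ a)) x y r,
    integral_const_mul, integral_finsetSum _ fun a _ => hx y hy a]
  ring

omit H [SigmaFinite ν] in
-- Multilinearity in the rows; it converts the sum over a in the scalar kernel into the sum over
-- sections s.
theorem det_sum_rows {I A : Type*} [Fintype I] [DecidableEq I] [Fintype A] [DecidableEq A]
    (M : A → I → I → ℂ) :
    (Matrix.of fun p q => ∑ a, M a p q).det =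
      ∑ s : I → A, (Matrix.of fun p q => M (s p) p q).det := by
  have h := (Matrix.detRowAlternating (n := I) (R := ℂ)).toMultilinearMap.map_sum
    (fun p a => M a p)
  refine Eq.trans ?_ h
  show Matrix.detRowAlternating _ = Matrix.detRowAlternating _
  congr 1
  ext p q
  simp

theorem Admissible.kernelMinor_ae_eq (n : ℕ) :
    ∀ᵐ x : Fin n → ℝ ∂(Measure.pi fun _ => halfLine),
      kernelMinor (scalarKernel ν (transform μ (φ 0)) (transform μ (φ 1))) x =
      ∑ s : Fin n → Fin 2, (Matrix.of fun p q => ∫ r,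
        leftFactor (fun a => transform μ (φ a)) (s p) (r + x p) *
          transform μ (φ (s p)) (r + x q) ∂ν).det := by
  have hpos : ∀ᵐ x ∂halfLine, 0 ≤ x :=
    (ae_restrict_mem measurableSet_Ioi).mono fun x hx => le_of_lt hx
  filter_upwards [ae_pi_forall (I := Fin n) fun _ => H.scalarKernel_eq,
    ae_pi_forall (I := Fin n) fun _ => hpos] with x hx hx0
  rw [kernelMinor, ← det_sum_rows fun a p q => ∫ r,
    leftFactor (fun a => transform μ (φ a)) a (r + x p) * transform μ (φ a) (r + x q) ∂ν]
  congr 2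
  funext p q
  exact hx p (x q) (hx0 q)

theorem Admissible.integral_kernelMinor (n : ℕ) :
    Integrable (fun x : Fin n → ℝ =>
      kernelMinor (scalarKernel ν (transform μ (φ 0)) (transform μ (φ 1))) x)
      (Measure.pi fun _ => halfLine) ∧
    ∫ x : Fin n → ℝ, kernelMinor (scalarKernel ν (transform μ (φ 0)) (transform μ (φ 1))) x
      ∂(Measure.pi fun _ => halfLine) =
      ∑ k ∈ Finset.range (n + 1), (n.choose k : ℂ) *
        (Z μ ν (φ 0) (φ 1) k * Z μ ν (φ 0) (φ 1) (n - k)) := by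
  have hA := fun s : Fin n → Fin 2 => integral_det_comp_eq
    (fun p => H.memLp_leftFactor (s p)) (fun p => H.hilbertSchmidt (s p))
  have hae := H.kernelMinor_ae_eq n
  refine ⟨(integrable_finsetSum _ fun s _ => (hA s).1).congr (hae.mono fun x hx => hx.symm), ?_⟩
  rw [integral_congr_ae hae, integral_finsetSum _ fun s _ => (hA s).1]
  simp_rw [fun s => (hA s).2.2]
  rw [← integral_finsetSum _ fun s _ => (hA s).2.1]
  have h1 : ∀ᵐ r : Fin n → ℝ ∂(Measure.pi fun _ => ν), _ :=
    H.ae_good.mono fun r hr => sum_blockPf_pairMatrix H.measurable H.re_pos hr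
  rw [← integral_congr_ae h1, integral_finsetSum _ fun V _ => (H.integral_blockPf_mul_compl V).1]
  simp_rw [fun V => (H.integral_blockPf_mul_compl (P := Fin n) V).2, Finset.card_compl]
  -- The summand depends on V only through its size, whence the binomial coefficients.
  have h2 := Finset.sum_powerset_apply_card (x := (Finset.univ : Finset (Fin n)))
    (fun k => Z μ ν (φ 0) (φ 1) k * Z μ ν (φ 0) (φ 1) (n - k))
  simpa using h2

end ScalarKernel

end PfaffianDet

namespace PfaffianDet

open Filter Topology

/-! ### Power series in τ and the Cauchy product. -/

section Series

theorem kernelMinor_smul (K : ℝ → ℝ → ℂ) (τ : ℂ) {n : ℕ} (x : Fin n → ℝ) :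
    kernelMinor (fun x y => τ * K x y) x = τ ^ n * kernelMinor K x := by
  have : (Matrix.of fun i j : Fin n => τ * K (x i) (x j)) =
      τ • Matrix.of fun i j : Fin n => K (x i) (x j) := by
    ext; simp
  rw [kernelMinor, this, Matrix.det_smul, Fintype.card_fin, kernelMinor]

theorem summable_exp_series_of_le {c : ℕ → ℂ} {C : ℝ} (hc : ∀ n, ‖c n‖ ≤ C ^ n) (R : ℝ) :
    Summable fun n : ℕ => R ^ n * ‖c n‖ / n.factorial := by
  refine Summable.of_norm_bounded (g := fun n : ℕ => (|R| * C) ^ n / n.factorial)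
    (Real.summable_pow_div_factorial _) fun n => ?_
  rw [norm_div, norm_mul, norm_pow, norm_norm, mul_pow, Real.norm_natCast, Real.norm_eq_abs]
  gcongr
  exact hc n

theorem differentiable_exp_series {c : ℕ → ℂ} {C : ℝ} (hc : ∀ n, ‖c n‖ ≤ C ^ n) :
    Differentiable ℂ fun τ : ℂ => ∑' n : ℕ, (-τ) ^ n / (n.factorial : ℂ) * c n := by
  intro τ
  have h : DifferentiableOn ℂ (fun τ : ℂ => ∑' n : ℕ, (-τ) ^ n / (n.factorial : ℂ) * c n)
      (Metric.ball 0 (‖τ‖ + 1)) := by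
    refine Complex.differentiableOn_tsum_of_summable_norm (summable_exp_series_of_le hc (‖τ‖ + 1))
      (fun n => by fun_prop) Metric.isOpen_ball fun n w hw => ?_
    rw [norm_mul, norm_div, norm_pow, norm_neg, Complex.norm_natCast, div_mul_eq_mul_div]
    have : ‖w‖ ≤ ‖τ‖ + 1 := by simpa using (mem_ball_zero_iff.1 hw).le
    gcongr
  exact h.differentiableAt (Metric.isOpen_ball.mem_nhds (by simp))

theorem summable_norm_exp_series {c : ℕ → ℂ} {C : ℝ} (hc : ∀ n, ‖c n‖ ≤ C ^ n) (τ : ℂ) :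
    Summable fun n : ℕ => ‖(-τ) ^ n / (n.factorial : ℂ) * c n‖ := by
  refine (summable_exp_series_of_le hc ‖τ‖).congr fun n => ?_
  rw [norm_mul, norm_div, norm_pow, norm_neg, Complex.norm_natCast, div_mul_eq_mul_div]

variable {μ : ContourMeasure} {φ : Fin 2 → ℂ → ℂ} {ν : Measure ℝ} [SigmaFinite ν]

/-- The binomial coefficient divided by n! splits as 1/(k! (n-k)!), which is the Cauchy product of
the series with itself. -/
theorem Admissible.fredholmTerm_eq (H : Admissible μ φ ν) (τ : ℂ) (n : ℕ) :
    fredholmTerm (fun x y => τ * scalarKernel ν (transform μ (φ 0)) (transform μ (φ 1)) x y) n =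
      ∑ k ∈ Finset.range (n + 1), ((-τ) ^ k / (k.factorial : ℂ) * Z μ ν (φ 0) (φ 1) k) *
        ((-τ) ^ (n - k) / ((n - k).factorial : ℂ) * Z μ ν (φ 0) (φ 1) (n - k)) := by
  simp_rw [fredholmTerm, kernelMinor_smul]
  rw [integral_const_mul, (H.integral_kernelMinor n).2, Finset.mul_sum, Finset.mul_sum]
  refine Finset.sum_congr rfl fun k hk => ?_
  have hk : k ≤ n := Nat.lt_succ_iff.1 (Finset.mem_range.1 hk)
  have h0 : ∀ j : ℕ, (j.factorial : ℂ) ≠ 0 := fun j => by exact_mod_cast Nat.factorial_ne_zero j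
  have h1 : (-τ) ^ k * (-τ) ^ (n - k) = (-1) ^ n * τ ^ n := by
    rw [← pow_add, Nat.add_sub_cancel' hk, neg_pow]
  rw [Nat.cast_choose ℂ hk]
  have := h0 n; have := h0 k; have := h0 (n - k)
  field_simp
  linear_combination (-(Z μ ν (φ 0) (φ 1) k * Z μ ν (φ 0) (φ 1) (n - k))) * h1

theorem Admissible.fredholm (H : Admissible μ φ ν) (τ : ℂ) :
    FredholmConverges (fun x y =>
      τ * scalarKernel ν (transform μ (φ 0)) (transform μ (φ 1)) x y) ∧
    (∑' n : ℕ, (-τ) ^ n / (n.factorial : ℂ) * Z μ ν (φ 0) (φ 1) n) ^ 2 =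
      fredholmDet (fun x y =>
        τ * scalarKernel ν (transform μ (φ 0)) (transform μ (φ 1)) x y) := by
  have hs := summable_norm_exp_series H.norm_Z_le τ
  refine ⟨⟨fun n => ?_, ?_⟩, ?_⟩
  · simp_rw [kernelMinor_smul]
    exact (H.integral_kernelMinor n).1.const_mul _
  · rw [funext fun n => H.fredholmTerm_eq τ n]
    exact (summable_norm_sum_mul_range_of_summable_norm hs hs).of_norm
  · rw [sq, tsum_mul_tsum_eq_tsum_sum_range_of_summable_norm hs hs, fredholmDet]
    exact tsum_congr fun n => (H.fredholmTerm_eq τ n).symm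

theorem Z_zero (ν : Measure ℝ) (φodd φeven : ℂ → ℂ) : Z μ ν φodd φeven 0 = 1 := by
  simp [Z, momentInner, momentIntegrand, pfaffian, measureReal_def, Measure.pi_empty_univ]

theorem Q_eq_tsum (ν : ℝ → Measure ℝ) (φodd φeven : ℂ → ℂ) (z : ℝ)
    (hs : Summable fun n : ℕ => (-1) ^ n / (n.factorial : ℂ) * Z μ (ν z) φodd φeven n) :
    Q μ ν φodd φeven z = ∑' n : ℕ, (-1) ^ n / (n.factorial : ℂ) * Z μ (ν z) φodd φeven n := by
  rw [hs.tsum_eq_zero_add, Q, Z_zero]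
  simp

end Series

/-- The single integrand built from |φ 0| + |φ 1| dominates all four pairs, and Fubini turns the
joint L² conditions into conditions at almost every r. -/
theorem admissible_of_hypotheses {μ : ContourMeasure} {ν : Measure ℝ} [SigmaFinite ν]
    {φ : Fin 2 → ℂ → ℂ} (hφ : ∀ a, Measurable (φ a)) (hC : ∀ v ∈ μ.C, 0 < v.re)
    (hint : ∀ a, ∀ᵐ r ∂ν, TransformIntegrable μ (φ a) r)
    (hK : ∀ᵐ r ∂ν, Integrable
      (fun p : ℂ × ℂ => (‖φ 0 p.1‖ + ‖φ 1 p.1‖) * (‖φ 0 p.2‖ + ‖φ 1 p.2‖) *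
        ‖(p.1 - p.2) / (p.1 + p.2)‖ * Real.exp (-r * (p.1.re + p.2.re)))
      (μ.total.prod μ.total))
    (hHS : ∀ a, ShiftHilbertSchmidt ν (transform μ (φ a)))
    (hHS' : ∀ a, ShiftHilbertSchmidt ν (deriv (transform μ (φ a)))) : Admissible μ φ ν where
  re_pos := hC
  measurable := hφ
  hilbertSchmidt := hHS
  hilbertSchmidt_deriv := hHS'
  good := by
    filter_upwards [ae_all_iff.2 hint, hK, ae_all_iff.2 fun a => memLp_two_section (hHS a),
      ae_all_iff.2 fun a => memLp_two_section (hHS' a)] with r h1 h2 h3 h4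
    refine ⟨h1, fun a b => ?_, fun a => ⟨h3 a, h4 a⟩⟩
    have hle : ∀ a v, ‖φ a v‖ ≤ ‖φ 0 v‖ + ‖φ 1 v‖ := by
      intro a v
      fin_cases a <;> simp
    have hm : Measurable fun p : ℂ × ℂ => ‖φ a p.1‖ * ‖φ b p.2‖ *
        ‖(p.1 - p.2) / (p.1 + p.2)‖ * Real.exp (-r * (p.1.re + p.2.re)) := by
      have := hφ a
      have := hφ b
      fun_prop
    refine h2.mono' hm.aestronglyMeasurable (Eventually.of_forall fun p => ?_)
    rw [Real.norm_of_nonneg (by positivity)]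
    gcongr
    · exact hle a _
    · exact hle b _

end PfaffianDet
theorem mainTheorem1
    (μ : ContourMeasure) (ν : ℝ → Measure ℝ) (z : ℝ) [SigmaFinite (ν z)]
    (φodd φeven : ℂ → ℂ) (hφodd : Measurable φodd) (hφeven : Measurable φeven)
    -- the contour lies in the open right half-plane
    (hC : ∀ v ∈ μ.C, 0 < v.re)
    -- the integrals for `f_odd`, `f_odd'`, `f_even`, `f_even'` converge absolutely at `ν_z`-a.e. `r`
    (hodd : ∀ᵐ r ∂(ν z), Integrable
      (fun v : ℂ => (1 + ‖v‖) * ‖φodd v‖ * Real.exp (-r * v.re)) μ.total)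
    (heven : ∀ᵐ r ∂(ν z), Integrable
      (fun v : ℂ => (1 + ‖v‖) * ‖φeven v‖ * Real.exp (-r * v.re)) μ.total)
    -- the double integrals against `(v - w) / (v + w)` converge absolutely
    (hK : ∀ᵐ r ∂(ν z), Integrable
      (fun p : ℂ × ℂ => (‖φodd p.1‖ + ‖φeven p.1‖) * (‖φodd p.2‖ + ‖φeven p.2‖) *
        ‖(p.1 - p.2) / (p.1 + p.2)‖ * Real.exp (-r * (p.1.re + p.2.re)))
      (μ.total.prod μ.total))
    -- the four kernels `f(r + x)`, `f'(r + x)` are Hilbert-Schmidt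
    (hHSodd : ShiftHilbertSchmidt (ν z) (transform μ φodd))
    (hHSodd' : ShiftHilbertSchmidt (ν z) (deriv (transform μ φodd)))
    (hHSeven : ShiftHilbertSchmidt (ν z) (transform μ φeven))
    (hHSeven' : ShiftHilbertSchmidt (ν z) (deriv (transform μ φeven))) :
    -- every `Z(n, z)` is given by convergent integrals
    (∀ n : ℕ,
      (∀ᵐ r : Fin n → ℝ ∂(Measure.pi fun _ => ν z),
        Integrable (fun X : Fin n × Fin 2 → ℂ => momentIntegrand μ φodd φeven r X)
          (Measure.pi fun _ => μ.total)) ∧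
      Integrable (fun r : Fin n → ℝ => momentInner μ φodd φeven r)
        (Measure.pi fun _ => ν z)) ∧
    -- the scalar kernel is well defined
    (∀ᵐ r ∂(ν z), ∀ x : ℝ, 0 < x →
      DifferentiableAt ℝ (transform μ φodd) (r + x) ∧
      DifferentiableAt ℝ (transform μ φeven) (r + x)) ∧
    (∀ᵐ x ∂halfLine, ∀ y : ℝ, 0 ≤ y →
      Integrable (kernelIntegrand (transform μ φodd) (transform μ φeven) x y) (ν z)) ∧
    FredholmConverges (scalarKernel (ν z) (transform μ φodd) (transform μ φeven)) ∧
    -- `Q(z)` is a square root of the Fredholm determinant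
    Q μ ν φodd φeven z ^ 2 =
      fredholmDet (scalarKernel (ν z) (transform μ φodd) (transform μ φeven)) ∧
    -- it is the principal one when `Re Q(z) > 0` or `Q(z) = 0`
    (0 < (Q μ ν φodd φeven z).re ∨ Q μ ν φodd φeven z = 0 →
      Q μ ν φodd φeven z =
        fredholmDet (scalarKernel (ν z) (transform μ φodd) (transform μ φeven)) ^ (1 / 2 : ℂ)) ∧
    -- in general it is the value at `τ = 1` of the analytic branch of the square root of
    -- `Det [I - τ K̄]` that equals `1` at `τ = 0`, and this branch is the series of `Q` for `τ ν_z`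
    ∃ q : ℂ → ℂ, Differentiable ℂ q ∧ q 0 = 1 ∧ q 1 = Q μ ν φodd φeven z ∧
      ∀ τ : ℂ,
        HasSum (fun n : ℕ => (-τ) ^ n / (n.factorial : ℂ) * Z μ (ν z) φodd φeven n) (q τ) ∧
        FredholmConverges (fun x y =>
          τ * scalarKernel (ν z) (transform μ φodd) (transform μ φeven) x y) ∧
        q τ ^ 2 = fredholmDet (fun x y =>
          τ * scalarKernel (ν z) (transform μ φodd) (transform μ φeven) x y) := by
  have hφ : ∀ a : Fin 2, Measurable ((![φodd, φeven] : Fin 2 → ℂ → ℂ) a) := by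
    intro a; fin_cases a <;> assumption
  have H : Admissible μ ![φodd, φeven] (ν z) :=
    admissible_of_hypotheses hφ hC (by intro a; fin_cases a <;> assumption) hK
      (by intro a; fin_cases a <;> assumption) (by intro a; fin_cases a <;> assumption)
  have hs : ∀ τ : ℂ, Summable fun n : ℕ =>
      (-τ) ^ n / (n.factorial : ℂ) * Z μ (ν z) φodd φeven n :=
    fun τ => (summable_norm_exp_series H.norm_Z_le τ).of_norm
  have hQ : Q μ ν φodd φeven z =
      ∑' n : ℕ, (-1) ^ n / (n.factorial : ℂ) * Z μ (ν z) φodd φeven n :=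
    Q_eq_tsum ν φodd φeven z (hs 1)
  have hF1 := H.fredholm 1
  simp only [one_mul] at hF1
  have hsq : Q μ ν φodd φeven z ^ 2 =
      fredholmDet (scalarKernel (ν z) (transform μ φodd) (transform μ φeven)) := by
    rw [hQ]; exact hF1.2
  refine ⟨fun n => ⟨?_, H.integrable_momentInner n⟩, ?_, H.integrable_kernelIntegrand, hF1.1, hsq,
    ?_, fun τ => ∑' n : ℕ, (-τ) ^ n / (n.factorial : ℂ) * Z μ (ν z) φodd φeven n,
    differentiable_exp_series H.norm_Z_le, ?_, hQ.symm, fun τ =>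
      ⟨(hs τ).hasSum, H.fredholm τ⟩⟩
  · exact H.ae_good.mono fun r hr => integrable_momentIntegrand hφ hC hr
  · filter_upwards [H.good] with r hr x hx
    exact ⟨((hr.transform 0).hasDerivAt hφodd hC hx).differentiableAt,
      ((hr.transform 1).hasDerivAt hφeven hC hx).differentiableAt⟩
  -- The principal root inverts squaring on the open right half-plane; the value 0 needs separate
  -- treatment.
  · rw [← hsq, one_div]
    rintro (h | h)
    · exact (Complex.sq_cpow_two_inv h).symm
    · simp [h]
  · simp only [neg_zero]
    rw [tsum_eq_single 0 fun n hn => by simp [hn]]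
    simp [Z_zero]
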